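/- **Conventions.** Composition is written in diagrammatic order, $f⨾g$ = first $f$, then $g$. "Symmetric monoidal functor" means lax symmetric monoidal functor, with comparison arrows $F_\epsilon\colon I\to FI$ and $\widetilde F\colon FA\otimes FB\to F(A\otimes B)$. For a category $\mathsf V$ with symmetric monoidal structure, a *monoidal $\mathsf V$-category* $(\mathsf C,\boxtimes,I_{\mathsf C})$ is a $\mathsf V$-category with a $\mathsf V$-functor $\boxtimes\colon \mathsf C\otimes\mathsf C\to\mathsf C$, a unit object $I_{\mathsf C}$ and invertible $\mathsf V$-natural transformations $a_{X,Y,Z}\colon I\to\mathsf C((X\boxtimes Y)\boxtimes Z,X\boxtimes(Y\boxtimes Z))$, $l_X\colon I\to\mathsf C(I_{\mathsf C}\boxtimes X,X)$, $r_X\colon I\to \mathsf C(X\boxtimes I_{\mathsf C},X)$ satisfying the pentagon and triangle identities in the underlying category; it is *symmetric* if it is equipped with a $\mathsf V$-natural $s_{X,Y}\colon I\to\mathsf C(X\boxtimes Y,Y\boxtimes X)$ that satisfies $s_{X,Y}⨾s_{Y,X}=\mathsf{id}$, the hexagon and the unit axiom. A *nearly strict monoidal 2-category* is a (strict) 2-category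 $\mathcal B$ with a pseudofunctor $\boxtimes\colon\mathcal B\times\mathcal B\to\mathcal B$, a unit object, and strictly 2-natural, strictly invertible 1-cells $a,l,r$ satisfying the pentagon and triangle identities as equations of 1-cells. Inverting the composition constraints of $\boxtimes$ gives the *tensorators* $\vartheta_{f_1,f_2,g_1,g_2}\colon (f_1\boxtimes f_2)⨾(g_1\boxtimes g_2)\Rightarrow(f_1⨾g_1)\boxtimes(f_2⨾g_2)$. It is *symmetric* if it is equipped with a strong (pseudo-)natural transformation with 1-cell components $s_{X,Y}\colon X\boxtimes Y\to Y\boxtimes X$ satisfying $s_{X,Y}⨾s_{Y,X}=\mathsf{id}$, the hexagon and the unit axiom as equations of 1-cells. **Theorem.** Let $\mathsf V$ and $\mathsf W$ be symmetric monoidal categories, $(M,\mu,\eta,\nabla)$ a symmetric monoidal monad on $\mathsf W$ (a lax symmetric monoidal endofunctor with comparison $\nabla$ and monoidal $\mu,\eta$), $F\colon\mathsf V\to\mathsf W$ a symmetric monoidal functor, and $\mathsf U$ a full strict monoidal subcategory of $\mathsf W$, i.e. a class of objects that contains $I$, is closed under $\otimes$, and on which the associators and unitors of $\mathsf W$ are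 identities. Let $\mathrm{Kl}_M$ be the Kleisli category with its induced symmetric monoidal structure, $L_M\colon\mathsf W\to\mathrm{Kl}_M$, $f\mapsto f⨾\eta$, the canonical functor, and $\mathsf U/(-)\colon\mathrm{Kl}_M\to\mathsf{Cat}$ the partial slice functor: $\mathsf U/A$ has as objects the $\mathrm{Kl}_M$-arrows $U_1\to A$ with $U_1\in\mathsf U$ and as arrows the commuting triangles of $\mathrm{Kl}_M$-arrows; it is lax monoidal via $(f_1,f_2)\mapsto f_1\otimes f_2$ and $\mathsf{id}_I$. Put $$\mathrm{Para}\colon \mathsf V\xrightarrow{F}\mathsf W\xrightarrow{L_M}\mathrm{Kl}_M\xrightarrow{\mathsf U/(-)}\mathsf{Cat}.$$ For every $\mathsf V$-category $\mathsf C$, change of base along $\mathrm{Para}$ gives a (strict) 2-category $\mathrm{Para}_*\mathsf C$ with the following explicit description. 1. The 0-cells are the objects of $\mathsf C$. 2. The 1-cells $X\to Y$ are the $\mathrm{Kl}_M$-arrows $f\colon U_1\to F\mathsf C(X,Y)$ with $U_1\in\mathsf U$ (the parameter space of $f$). 3. The 2-cells from $f\colon U_1\to F\mathsf C(X,Y)$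 to $g\colon V_1\to F\mathsf C(X,Y)$ are the $\mathrm{Kl}_M$-arrows $\varphi\colon U_1\to V_1$ with $f=\varphi⨾g$; vertical composition and identities are those of $\mathrm{Kl}_M$. 4. The horizontal composite of $f_1\colon U_1\to F\mathsf C(X,Y)$ and $f_2\colon U_2\to F\mathsf C(Y,Z)$ is $(f_1\otimes f_2)⨾(\widetilde F⨾F(⨾_{\mathsf C})⨾\eta)\colon U_1\otimes U_2\to F\mathsf C(X,Z)$, that of 2-cells $\varphi_1,\varphi_2$ is $\varphi_1\otimes\varphi_2$, and the identity 1-cell of $X$ is $F_\epsilon⨾F(\mathsf{id}_X)⨾\eta\colon I\to F\mathsf C(X,X)$. 5. If $\mathsf C$ is a monoidal $\mathsf V$-category, then $\mathrm{Para}_*\mathsf C$ is a nearly strict monoidal 2-category. Its product is $\boxtimes$ on 0-cells, $(f_1\otimes f_2)⨾(\widetilde F⨾F(\boxtimes_{\mathsf C})⨾\eta)$ with parameter space $U_1\otimes U_2$ on 1-cells, and $\varphi_1\otimes\varphi_2$ on 2-cells; its unit is $I_{\mathsf C}$. The tensorator $\vartheta_{f_1,f_2,g_1,g_2}$, for $f_i$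 with parameter space $U_i$ and $g_i$ with parameter space $V_i$, is the image under $L_M$ of the middle-four interchange $(U_1\otimes U_2)\otimes(V_1\otimes V_2)\to(U_1\otimes V_1)\otimes(U_2\otimes V_2)$ of $\mathsf W$, and the unit constraint $\mathsf{id}_{X_1}\boxtimes\mathsf{id}_{X_2}\Rightarrow\mathsf{id}_{X_1\boxtimes X_2}$ is the identity on the parameter space $I\otimes I=I$. The 1-cells $a,l,r$ are lifted from $\mathsf C$, i.e. are $F_\epsilon⨾F(a^{\mathsf C})⨾\eta$, $F_\epsilon⨾F(l^{\mathsf C})⨾\eta$, $F_\epsilon⨾F(r^{\mathsf C})⨾\eta$, with parameter space $I$. 6. If moreover $\mathsf C$ is symmetric, then this nearly strict monoidal 2-category is symmetric, with $s_{X,Y}=F_\epsilon⨾F(s^{\mathsf C}_{X,Y})⨾\eta$; its naturality 2-cell $(f_1\boxtimes f_2)⨾s\Rightarrow s⨾(f_2\boxtimes f_1)$ is the image under $L_M$ of the swap $U_1\otimes U_2\to U_2\otimes U_1$ of the parameter spaces. -/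

import Mathlib

open CategoryTheory MonoidalCategory Functor.LaxMonoidal
universe v u v₁ u₁ w w₁ w₂ v₂ u₂ w₃ v₃ u₃ w₄ v₄ u₄
attribute [-instance] CategoryTheory.catToReflQuiver
set_option linter.unusedSectionVars false
set_option linter.unusedVariables false
set_option linter.style.longLine false

namespace ParaUncertainty
variable {W : Type u} [Category.{v} W] [MonoidalCategory W] [SymmetricCategory W]
  (M : Monad W) [M.toFunctor.LaxBraided] [NatTrans.IsMonoidal M.η] [NatTrans.IsMonoidal M.μ]

/-- The canonical functor `L_M : W ⥤ Kl_M`, `f ↦ f ⨾ η`. -/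
abbrev toKl {W : Type u} [Category.{v} W] (M : Monad W) : W ⥤ Kleisli M where
  obj X := .mk M X
  map {X Y} f := .mk (f ≫ M.η.app Y)
  map_id X := (Kleisli.Adjunction.toKleisli M).map_id X
  map_comp f g := (Kleisli.Adjunction.toKleisli M).map_comp f g

theorem toKl_eq {W : Type u} [Category.{v} W] (M : Monad W) :
    toKl M = Kleisli.Adjunction.toKleisli M := rfl

variable {M}

theorem monad_unit_tensor (X Y : W) :
    (M.η.app X ⊗ₘ M.η.app Y) ≫ μ M.toFunctor X Y = M.η.app (X ⊗ Y) := by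
  have := NatTrans.IsMonoidal.tensor (τ := M.η) X Y
  simpa using this.symm

theorem monad_unit_unit : ε M.toFunctor = M.η.app (𝟙_ W) := by
  have := NatTrans.IsMonoidal.unit (τ := M.η)
  simpa using this.symm

theorem monad_mul_tensor (X Y : W) :
    μ M.toFunctor (M.obj X) (M.obj Y) ≫ M.map (μ M.toFunctor X Y) ≫ M.μ.app (X ⊗ Y) =
      (M.μ.app X ⊗ₘ M.μ.app Y) ≫ μ M.toFunctor X Y := by
  have := NatTrans.IsMonoidal.tensor (τ := M.μ) X Y
  simpa using this

/-- The monoidal structure of the Kleisli category: `f ⊗ g` is `(f ⊗ g) ⨾ ∇`, and the coherence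
isomorphisms are the images under `L_M` of those of `W`. -/
instance kleisliStruct : MonoidalCategoryStruct (Kleisli M) where
  tensorObj X Y := .mk M (X.of ⊗ Y.of)
  tensorUnit := .mk M (𝟙_ W)
  tensorHom f g := .mk ((f.of ⊗ₘ g.of) ≫ μ M.toFunctor _ _)
  whiskerLeft X _ _ f := .mk ((M.η.app X.of ⊗ₘ f.of) ≫ μ M.toFunctor _ _)
  whiskerRight f Y := .mk ((f.of ⊗ₘ M.η.app Y.of) ≫ μ M.toFunctor _ _)
  associator X Y Z := (toKl M).mapIso (α_ X.of Y.of Z.of)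
  leftUnitor X := (toKl M).mapIso (λ_ X.of)
  rightUnitor X := (toKl M).mapIso (ρ_ X.of)

theorem kl_comp_toKl {X : Kleisli M} {Y Z : W} (f : X ⟶ (toKl M).obj Y) (g : Y ⟶ Z) :
    (f ≫ (toKl M).map g).of = f.of ≫ M.map g := by
  change f.of ≫ M.map (g ≫ M.η.app Z) ≫ M.μ.app Z = _
  rw [M.map_comp, Category.assoc, M.right_unit]
  exact congrArg _ (Category.comp_id _)

theorem toKl_comp_kl {X Y : W} {Z : Kleisli M} (f : X ⟶ Y) (g : (toKl M).obj Y ⟶ Z) :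
    ((toKl M).map f ≫ g).of = f ≫ g.of := by
  change (f ≫ M.η.app Y) ≫ M.map g.of ≫ M.μ.app Z.of = _
  have h : M.η.app Y ≫ M.map g.of = g.of ≫ M.η.app (M.obj Z.of) := (M.η.naturality g.of).symm
  rw [Category.assoc, reassoc_of% h, M.left_unit]
  exact congrArg _ (Category.comp_id _)

theorem toKl_tensor {X₁ X₂ Y₁ Y₂ : W} (f : X₁ ⟶ Y₁) (g : X₂ ⟶ Y₂) :
    MonoidalCategoryStruct.tensorHom ((toKl M).map f) ((toKl M).map g) =
      (toKl M).map (f ⊗ₘ g) := by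
  apply Kleisli.hom_ext
  change ((f ≫ M.η.app Y₁) ⊗ₘ (g ≫ M.η.app Y₂)) ≫ μ M.toFunctor _ _ = (f ⊗ₘ g) ≫ M.η.app _
  rw [← monad_unit_tensor, tensorHom_comp_tensorHom_assoc]

instance kleisliMonoidal : MonoidalCategory (Kleisli M) :=
  .ofTensorHom
  (id_tensorHom_id := fun X Y => by
    apply Kleisli.hom_ext
    exact monad_unit_tensor _ _)
  (id_tensorHom := fun _ _ _ _ => rfl)
  (tensorHom_id := fun _ _ => rfl)
  (tensorHom_comp_tensorHom := fun {X₁ Y₁ Z₁ X₂ Y₂ Z₂} f₁ f₂ g₁ g₂ => by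
    apply Kleisli.hom_ext
    change ((f₁.of ⊗ₘ f₂.of) ≫ μ M.toFunctor _ _) ≫ M.map ((g₁.of ⊗ₘ g₂.of) ≫ μ M.toFunctor _ _) ≫ 
       M.μ.app _ = ((f₁.of ≫ M.map g₁.of ≫ M.μ.app _) ⊗ₘ (f₂.of ≫ M.map g₂.of ≫ M.μ.app _)) ≫ μ M.toFunctor _ _
    simp only [M.map_comp, Category.assoc]
    rw [← μ_natural_assoc, monad_mul_tensor]
    simp only [tensorHom_comp_tensorHom_assoc])
  (associator_naturality := fun {X₁ X₂ X₃ Y₁ Y₂ Y₃} f₁ f₂ f₃ => by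
    apply Kleisli.hom_ext
    refine (kl_comp_toKl _ _).trans (Eq.trans ?_ (toKl_comp_kl _ _).symm)
    change ((((f₁.of ⊗ₘ f₂.of) ≫ μ M.toFunctor _ _) ⊗ₘ f₃.of) ≫ μ M.toFunctor _ _) ≫ M.map (α_ _ _ _).hom =
      (α_ _ _ _).hom ≫ (f₁.of ⊗ₘ ((f₂.of ⊗ₘ f₃.of) ≫ μ M.toFunctor _ _)) ≫ μ M.toFunctor _ _
    have h := associativity M.toFunctor Y₁.of Y₂.of Y₃.of
    rw [← Category.comp_id f₃.of, ← tensorHom_comp_tensorHom, Category.assoc, Category.assoc, tensorHom_id, h,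
      associator_naturality_assoc, ← Category.comp_id f₁.of, ← tensorHom_comp_tensorHom, id_tensorHom]
    simp only [Category.comp_id, Category.assoc])
  (leftUnitor_naturality := fun {X Y} f => by
    apply Kleisli.hom_ext
    refine (kl_comp_toKl _ _).trans (Eq.trans ?_ (toKl_comp_kl _ _).symm)
    change ((M.η.app (𝟙_ W) ⊗ₘ f.of) ≫ μ M.toFunctor _ _) ≫ M.map (λ_ _).hom = (λ_ _).hom ≫ f.of
    rw [← leftUnitor_naturality, left_unitality M.toFunctor, monad_unit_unit, ← Category.assoc, ← Category.assoc, MonoidalCategory.tensorHom_def']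
    rfl)
  (rightUnitor_naturality := fun {X Y} f => by
    apply Kleisli.hom_ext
    refine (kl_comp_toKl _ _).trans (Eq.trans ?_ (toKl_comp_kl _ _).symm)
    change ((f.of ⊗ₘ M.η.app (𝟙_ W)) ≫ μ M.toFunctor _ _) ≫ M.map (ρ_ _).hom = (ρ_ _).hom ≫ f.of
    rw [← rightUnitor_naturality, right_unitality M.toFunctor, monad_unit_unit, ← Category.assoc, ← Category.assoc, MonoidalCategory.tensorHom_def]
    rfl)
  (pentagon := fun X₁ X₂ X₃ X₄ => by
    have h := congrArg (toKl M).map (MonoidalCategory.pentagon X₁.of X₂.of X₃.of X₄.of)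
    rw [← tensorHom_id, ← id_tensorHom, (toKl M).map_comp, (toKl M).map_comp, (toKl M).map_comp,
      ← toKl_tensor, ← toKl_tensor, (toKl M).map_id, (toKl M).map_id] at h
    exact h)
  (triangle := fun X Y => by
    have h := congrArg (toKl M).map (MonoidalCategory.triangle X.of Y.of)
    rw [← tensorHom_id, ← id_tensorHom, (toKl M).map_comp,
      ← toKl_tensor, ← toKl_tensor, (toKl M).map_id, (toKl M).map_id] at h
    exact h)

instance kleisliBraided : BraidedCategory (Kleisli M) where
  braiding X Y := (toKl M).mapIso (β_ X.of Y.of)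
  braiding_naturality_right X Y Z f := by
    apply Kleisli.hom_ext
    refine (kl_comp_toKl _ _).trans (Eq.trans ?_ (toKl_comp_kl _ _).symm)
    change ((M.η.app X.of ⊗ₘ f.of) ≫ μ M.toFunctor _ _) ≫ M.map (β_ _ _).hom =
      (β_ _ _).hom ≫ (f.of ⊗ₘ M.η.app X.of) ≫ μ M.toFunctor _ _
    have h := BraidedCategory.braiding_naturality_assoc (M.η.app X.of) f.of (μ M.toFunctor _ _)
    rw [Category.assoc, Functor.LaxBraided.braided, h]
  braiding_naturality_left f Z := by
    apply Kleisli.hom_ext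
    refine (kl_comp_toKl _ _).trans (Eq.trans ?_ (toKl_comp_kl _ _).symm)
    change ((f.of ⊗ₘ M.η.app Z.of) ≫ μ M.toFunctor _ _) ≫ M.map (β_ _ _).hom =
      (β_ _ _).hom ≫ (M.η.app Z.of ⊗ₘ f.of) ≫ μ M.toFunctor _ _
    have h := BraidedCategory.braiding_naturality_assoc f.of (M.η.app Z.of) (μ M.toFunctor _ _)
    rw [Category.assoc, Functor.LaxBraided.braided, h]
  hexagon_forward X Y Z := by
    have h := congrArg (toKl M).map (BraidedCategory.hexagon_forward X.of Y.of Z.of)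
    rw [← tensorHom_id, ← id_tensorHom, (toKl M).map_comp, (toKl M).map_comp, (toKl M).map_comp,
      (toKl M).map_comp, ← toKl_tensor, ← toKl_tensor, (toKl M).map_id, (toKl M).map_id] at h
    exact h
  hexagon_reverse X Y Z := by
    have h := congrArg (toKl M).map (BraidedCategory.hexagon_reverse X.of Y.of Z.of)
    rw [← tensorHom_id, ← id_tensorHom, (toKl M).map_comp, (toKl M).map_comp, (toKl M).map_comp,
      (toKl M).map_comp, ← toKl_tensor, ← toKl_tensor, (toKl M).map_id, (toKl M).map_id] at h
    exact h

instance kleisliSymmetric : SymmetricCategory (Kleisli M) where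
  symmetry X Y := by
    change (toKl M).map (β_ _ _).hom ≫ (toKl M).map (β_ _ _).hom = _
    rw [← CategoryTheory.Functor.map_comp, SymmetricCategory.symmetry, CategoryTheory.Functor.map_id]
    rfl

/-- `L_M` is a strict symmetric monoidal functor. -/
instance toKlBraided : (toKl M).LaxBraided where
  ε := 𝟙 _
  μ X Y := 𝟙 _
  μ_natural_left f X := by
    rw [Category.comp_id, Category.id_comp, ← tensorHom_id, ← tensorHom_id,
      ← toKl_tensor, CategoryTheory.Functor.map_id]
  μ_natural_right X f := by
    rw [Category.comp_id, Category.id_comp, ← id_tensorHom, ← id_tensorHom,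
      ← toKl_tensor, CategoryTheory.Functor.map_id]
  associativity X Y Z := by
    rw [id_whiskerRight, MonoidalCategory.whiskerLeft_id]
    simp only [Category.id_comp, Category.comp_id]
    rfl
  left_unitality X := by
    rw [id_whiskerRight]
    simp only [Category.id_comp]
    rfl
  right_unitality X := by
    rw [MonoidalCategory.whiskerLeft_id]
    simp only [Category.id_comp]
    rfl
  braided X Y := by
    rw [Category.comp_id, Category.id_comp]
    rfl


section slice

/-- The full subcategory of `Kl_M` on the objects of `U`. -/
abbrev klSub {W : Type u} [Category.{v} W] (M : Monad W) (P : ObjectProperty W) : ObjectProperty (Kleisli M) := fun X => P X.of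

/-- The partial slice functor `U/(-) : Kl_M ⥤ Cat`: objects of `U/A` are pairs of an object `U₁` of
`U` and an arrow `U₁ ⟶ A` of `Kl_M`, and arrows are commuting triangles. -/
abbrev partialSlice {W : Type u} [Category.{v} W] (M : Monad W) (P : ObjectProperty W) : Kleisli M ⥤ Cat.{v, max u v} := CostructuredArrow.functor (klSub M P).ι

/-- The full subcategory of `W` on the objects satisfying `P` is a strict monoidal subcategory: it
contains the unit, is closed under `⊗`, and the associators and unitors of its objects are
identities. -/
class IsStrictMonoidalSub (P : ObjectProperty W) : Prop extends P.IsMonoidal where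
  assoc (X Y Z : W) : P X → P Y → P Z → ∃ h : (X ⊗ Y) ⊗ Z = X ⊗ (Y ⊗ Z), (α_ X Y Z).hom = eqToHom h
  left (X : W) : P X → ∃ h : 𝟙_ W ⊗ X = X, (λ_ X).hom = eqToHom h
  right (X : W) : P X → ∃ h : X ⊗ 𝟙_ W = X, (ρ_ X).hom = eqToHom h

theorem slice_functor_ext {D : Type*} [Category D] {M : Monad W} {P : ObjectProperty W}
    {A : Kleisli M} {F G : D ⥤ CostructuredArrow (klSub M P).ι A}
    (e : ∀ x, (F.obj x).left.obj ⟶ (G.obj x).left.obj)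
    (he : ∀ x, ∃ h : (F.obj x).left.obj = (G.obj x).left.obj, e x = eqToHom h)
    (hh : ∀ x, (F.obj x).hom = e x ≫ (G.obj x).hom)
    (hm : ∀ x y (f : x ⟶ y), (F.map f).left.hom ≫ e y = e x ≫ (G.map f).left.hom) :
    F = G := by
  have key (X Y : (klSub M P).FullSubcategory) (h : X = Y) (h' : X.obj = Y.obj) :
      (eqToHom h).hom = eqToHom h' := by
    subst h; rfl
  have hl : ∀ x, (F.obj x).left = (G.obj x).left := fun x => by
    have := (he x).choose
    generalize (F.obj x).left = a at *
    generalize (G.obj x).left = b at *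
    cases a; cases b; cases this; rfl
  have hk : ∀ x (h : (F.obj x).left = (G.obj x).left), (eqToHom h).hom = e x := fun x h =>
    (key _ _ h (he x).choose).trans (he x).choose_spec.symm
  have ho : ∀ x, F.obj x = G.obj x := fun x =>
    CostructuredArrow.obj_ext _ _ (hl x) (by
      rw [hh x]
      exact congrArg (· ≫ (G.obj x).hom) (hk x (hl x)))
  refine CategoryTheory.Functor.ext ho fun x y f => ?_
  rw [← Category.assoc, eq_comm, comp_eqToHom_iff, eq_comm]
  apply CostructuredArrow.hom_ext
  apply ObjectProperty.hom_ext
  refine Eq.trans ?_ ((hm x y f).trans ?_)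
  · refine congrArg ((F.map f).left.hom ≫ ·) ?_
    rw [CostructuredArrow.eqToHom_left]
    exact hk _ _
  · refine congrArg (· ≫ (G.map f).left.hom) ?_
    rw [CostructuredArrow.eqToHom_left]
    exact (hk _ _).symm

variable (M) (P : ObjectProperty W) [P.IsMonoidal]

/-- The comparison functor `U/A × U/B ⥤ U/(A ⊗ B)`, `(f₁, f₂) ↦ f₁ ⊗ f₂`. -/
def sliceμ (A B : Kleisli M) : CostructuredArrow (klSub M P).ι A × CostructuredArrow (klSub M P).ι B ⥤ CostructuredArrow (klSub M P).ι (A ⊗ B) where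
  obj x := CostructuredArrow.mk (S := (klSub M P).ι) (Y := (⟨x.1.left.obj ⊗ x.2.left.obj, P.prop_tensor x.1.left.property x.2.left.property⟩ : (klSub M P).FullSubcategory)) (x.1.hom ⊗ₘ x.2.hom)
  map {x y} φ := CostructuredArrow.homMk (ObjectProperty.homMk (φ.1.left.hom ⊗ₘ φ.2.left.hom)) (by
     have h1 : φ.1.left.hom ≫ y.1.hom = x.1.hom := CostructuredArrow.w φ.1
     have h2 : φ.2.left.hom ≫ y.2.hom = x.2.hom := CostructuredArrow.w φ.2
     change (φ.1.left.hom ⊗ₘ φ.2.left.hom) ≫ (y.1.hom ⊗ₘ y.2.hom) = (x.1.hom ⊗ₘ x.2.hom)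
     rw [← h1, ← h2]
     exact tensorHom_comp_tensorHom _ _ _ _)
  map_id x := by
    apply CostructuredArrow.hom_ext
    apply ObjectProperty.hom_ext
    exact id_tensorHom_id _ _
  map_comp f g := by
    apply CostructuredArrow.hom_ext
    apply ObjectProperty.hom_ext
    exact (tensorHom_comp_tensorHom _ _ _ _).symm

/-- The comparison functor `1 ⥤ U/I` picking out `𝟙 I`. -/
def sliceε : Cat.chosenTerminal.{v, max u v} ⥤ CostructuredArrow (klSub M P).ι (𝟙_ (Kleisli M)) :=
  (Functor.const _).obj (CostructuredArrow.mk (S := (klSub M P).ι) (Y := (⟨𝟙_ (Kleisli M), P.prop_unit⟩ : (klSub M P).FullSubcategory)) (𝟙 (𝟙_ (Kleisli M))))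

end slice

section
variable (M) (P : ObjectProperty W) [IsStrictMonoidalSub P]

theorem kl_assoc (X Y Z : Kleisli M) (hX : P X.of) (hY : P Y.of) (hZ : P Z.of) :
    ∃ h : (X ⊗ Y) ⊗ Z = X ⊗ (Y ⊗ Z), (α_ X Y Z).hom = eqToHom h := by
  obtain ⟨h, e⟩ := IsStrictMonoidalSub.assoc X.of Y.of Z.of hX hY hZ
  refine ⟨congrArg (Kleisli.mk M) h, ?_⟩
  change (toKl M).map (α_ X.of Y.of Z.of).hom = _
  rw [e, eqToHom_map]

theorem kl_left (X : Kleisli M) (hX : P X.of) :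
    ∃ h : 𝟙_ (Kleisli M) ⊗ X = X, (λ_ X).hom = eqToHom h := by
  obtain ⟨h, e⟩ := IsStrictMonoidalSub.left X.of hX
  refine ⟨congrArg (Kleisli.mk M) h, ?_⟩
  change (toKl M).map (λ_ X.of).hom = _
  rw [e, eqToHom_map]

theorem kl_right (X : Kleisli M) (hX : P X.of) :
    ∃ h : X ⊗ 𝟙_ (Kleisli M) = X, (ρ_ X).hom = eqToHom h := by
  obtain ⟨h, e⟩ := IsStrictMonoidalSub.right X.of hX
  refine ⟨congrArg (Kleisli.mk M) h, ?_⟩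
  change (toKl M).map (ρ_ X.of).hom = _
  rw [e, eqToHom_map]

instance partialSliceLax : (partialSlice M P).LaxMonoidal where
  ε := (sliceε M P).toCatHom
  μ A B := (sliceμ M P A B).toCatHom
  μ_natural_left {A B} f A' := by
    apply Cat.Hom.ext
    refine slice_functor_ext (fun x => 𝟙 _) (fun x => ⟨rfl, rfl⟩) (fun x => ?_) (fun x y f => ?_)
    · refine Eq.trans ?_ (Category.id_comp _).symm
      refine Eq.trans ?_ (congrArg ((x.1.hom ⊗ₘ x.2.hom) ≫ ·) (tensorHom_id f A'))
      exact ((tensorHom_comp_tensorHom x.1.hom x.2.hom f (𝟙 A')).trans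
        (congrArg (fun k : _ ⟶ A' => (x.1.hom ≫ f) ⊗ₘ k) (Category.comp_id x.2.hom))).symm
    · exact (Category.comp_id _).trans (Category.id_comp _).symm
  μ_natural_right {A B} A' f := by
    apply Cat.Hom.ext
    refine slice_functor_ext (fun x => 𝟙 _) (fun x => ⟨rfl, rfl⟩) (fun x => ?_) (fun x y f => ?_)
    · refine Eq.trans ?_ (Category.id_comp _).symm
      refine Eq.trans ?_ (congrArg ((x.1.hom ⊗ₘ x.2.hom) ≫ ·) (id_tensorHom A' f))
      exact ((tensorHom_comp_tensorHom x.1.hom x.2.hom (𝟙 A') f).trans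
        (congrArg (fun k : _ ⟶ A' => k ⊗ₘ (x.2.hom ≫ f)) (Category.comp_id x.1.hom))).symm
    · exact (Category.comp_id _).trans (Category.id_comp _).symm
  associativity A B C := by
    apply Cat.Hom.ext
    refine slice_functor_ext
      (fun x => (α_ x.1.1.left.obj x.1.2.left.obj x.2.left.obj).hom)
      (fun x => kl_assoc M P _ _ _ x.1.1.left.property x.1.2.left.property x.2.left.property)
      (fun x => ?_) (fun x y f => ?_)
    · exact associator_naturality x.1.1.hom x.1.2.hom x.2.hom
    · exact associator_naturality f.1.1.left.hom f.1.2.left.hom f.2.left.hom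
  left_unitality A := by
    symm
    apply Cat.Hom.ext
    refine slice_functor_ext (fun x => (λ_ x.2.left.obj).hom)
      (fun x => kl_left M P _ x.2.left.property) (fun x => ?_) (fun x y f => ?_)
    · exact (congrArg (· ≫ (λ_ A).hom) (id_tensorHom (𝟙_ (Kleisli M)) x.2.hom)).trans
        (leftUnitor_naturality x.2.hom)
    · exact (congrArg (· ≫ (λ_ y.2.left.obj).hom)
        (id_tensorHom (𝟙_ (Kleisli M)) f.2.left.hom)).trans (leftUnitor_naturality f.2.left.hom)
  right_unitality A := by
    symm
    apply Cat.Hom.ext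
    refine slice_functor_ext (fun x => (ρ_ x.1.left.obj).hom)
      (fun x => kl_right M P _ x.1.left.property) (fun x => ?_) (fun x y f => ?_)
    · exact (congrArg (· ≫ (ρ_ A).hom) (tensorHom_id x.1.hom (𝟙_ (Kleisli M)))).trans
        (rightUnitor_naturality x.1.hom)
    · exact (congrArg (· ≫ (ρ_ y.1.left.obj).hom)
        (tensorHom_id f.1.left.hom (𝟙_ (Kleisli M)))).trans (rightUnitor_naturality f.1.left.hom)

end

section enriched

variable {V : Type u₁} [Category.{v₁} V] [MonoidalCategory V] [SymmetricCategory V]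

/-- Composition in the underlying ordinary category `C₀`, whose arrows are points `I ⟶ C(X, Y)`. -/
abbrev comp0 {C : Type w} [EnrichedCategory V C] {X Y Z : C}
    (f : 𝟙_ V ⟶ (X ⟶[V] Y)) (g : 𝟙_ V ⟶ (Y ⟶[V] Z)) : 𝟙_ V ⟶ (X ⟶[V] Z) :=
  (λ_ (𝟙_ V)).inv ≫ (f ⊗ₘ g) ≫ eComp V X Y Z

/-- Invertibility in `C₀`. -/
abbrev IsIso0 {C : Type w} [EnrichedCategory V C] {X Y : C} (f : 𝟙_ V ⟶ (X ⟶[V] Y)) : Prop :=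
  ∃ g : 𝟙_ V ⟶ (Y ⟶[V] X), comp0 f g = eId V X ∧ comp0 g f = eId V Y

/-- One `V`-naturality square, for points `t : X ⟶ X'` and `t' : Y ⟶ Y'`, where
`Φ : D ⟶ C(X, Y)` and `Ψ : D ⟶ C(X', Y')` are the actions on a hom-object `D` of the two
`V`-functors: `t ⨾ Ψ(-) = Φ(-) ⨾ t'` as arrows `D ⟶ C(X, Y')`. -/
abbrev VNaturalAt {C : Type w} [EnrichedCategory V C] {D : V} {X X' Y Y' : C}
    (Φ : D ⟶ (X ⟶[V] Y)) (Ψ : D ⟶ (X' ⟶[V] Y'))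
    (t : 𝟙_ V ⟶ (X ⟶[V] X')) (t' : 𝟙_ V ⟶ (Y ⟶[V] Y')) : Prop :=
  (λ_ D).inv ≫ (t ⊗ₘ Ψ) ≫ eComp V X X' Y' = (ρ_ D).inv ≫ (Φ ⊗ₘ t') ≫ eComp V X Y Y'

variable (V) in
/-- The structure of a monoidal `V`-category on a `V`-category `C`: a `V`-functor
`⊠ : C ⊗ C ⟶ C`, a unit object, and invertible `V`-natural associator and unitors satisfying the
pentagon and triangle identities. -/
structure MonoidalVCat (C : Type w) [EnrichedCategory V C] where
  /-- The product `X ⊠ Y` of objects. -/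
  tensor : C → C → C
  /-- The unit object. -/
  unit : C
  /-- The action of `⊠` on hom-objects. -/
  tensorHom (X₁ Y₁ X₂ Y₂ : C) :
    (X₁ ⟶[V] Y₁) ⊗ (X₂ ⟶[V] Y₂) ⟶ (tensor X₁ X₂ ⟶[V] tensor Y₁ Y₂)
  tensorHom_id (X₁ X₂ : C) :
    (λ_ (𝟙_ V)).inv ≫ (eId V X₁ ⊗ₘ eId V X₂) ≫ tensorHom X₁ X₁ X₂ X₂ = eId V (tensor X₁ X₂)
  tensorHom_comp (X₁ Y₁ Z₁ X₂ Y₂ Z₂ : C) :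
    tensorμ (X₁ ⟶[V] Y₁) (Y₁ ⟶[V] Z₁) (X₂ ⟶[V] Y₂) (Y₂ ⟶[V] Z₂) ≫
        (tensorHom X₁ Y₁ X₂ Y₂ ⊗ₘ tensorHom Y₁ Z₁ Y₂ Z₂) ≫ eComp V _ _ _ =
      (eComp V X₁ Y₁ Z₁ ⊗ₘ eComp V X₂ Y₂ Z₂) ≫ tensorHom X₁ Z₁ X₂ Z₂
  /-- The associator. -/
  a (X Y Z : C) : 𝟙_ V ⟶ (tensor (tensor X Y) Z ⟶[V] tensor X (tensor Y Z))
  /-- The left unitor. -/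
  l (X : C) : 𝟙_ V ⟶ (tensor unit X ⟶[V] X)
  /-- The right unitor. -/
  r (X : C) : 𝟙_ V ⟶ (tensor X unit ⟶[V] X)
  a_iso (X Y Z : C) : IsIso0 (a X Y Z)
  l_iso (X : C) : IsIso0 (l X)
  r_iso (X : C) : IsIso0 (r X)
  a_natural (X₁ Y₁ X₂ Y₂ X₃ Y₃ : C) :
    VNaturalAt (D := ((X₁ ⟶[V] Y₁) ⊗ (X₂ ⟶[V] Y₂)) ⊗ (X₃ ⟶[V] Y₃))
      (tensorHom X₁ Y₁ X₂ Y₂ ▷ _ ≫ tensorHom _ _ X₃ Y₃)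
      ((α_ _ _ _).hom ≫ _ ◁ tensorHom X₂ Y₂ X₃ Y₃ ≫ tensorHom X₁ Y₁ _ _)
      (a X₁ X₂ X₃) (a Y₁ Y₂ Y₃)
  l_natural (X Y : C) :
    VNaturalAt (D := (X ⟶[V] Y)) ((λ_ _).inv ≫ eId V unit ▷ _ ≫ tensorHom unit unit X Y) (𝟙 _)
      (l X) (l Y)
  r_natural (X Y : C) :
    VNaturalAt (D := (X ⟶[V] Y)) ((ρ_ _).inv ≫ _ ◁ eId V unit ≫ tensorHom X Y unit unit) (𝟙 _)
      (r X) (r Y)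
  pentagon (A B D E : C) :
    comp0 ((λ_ (𝟙_ V)).inv ≫ (a A B D ⊗ₘ eId V E) ≫ tensorHom _ _ _ _)
        (comp0 (a A (tensor B D) E)
          ((λ_ (𝟙_ V)).inv ≫ (eId V A ⊗ₘ a B D E) ≫ tensorHom _ _ _ _)) =
      comp0 (a (tensor A B) D E) (a A B (tensor D E))
  triangle (A B : C) :
    comp0 (a A unit B) ((λ_ (𝟙_ V)).inv ≫ (eId V A ⊗ₘ l B) ≫ tensorHom _ _ _ _) =
      (λ_ (𝟙_ V)).inv ≫ (r A ⊗ₘ eId V B) ≫ tensorHom _ _ _ _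

/-- A symmetry on a monoidal `V`-category. -/
structure SymmetryVCat {C : Type w} [EnrichedCategory V C] (𝓜 : MonoidalVCat V C) where
  /-- The symmetry. -/
  s (X Y : C) : 𝟙_ V ⟶ (𝓜.tensor X Y ⟶[V] 𝓜.tensor Y X)
  s_natural (X₁ Y₁ X₂ Y₂ : C) :
    VNaturalAt (𝓜.tensorHom X₁ Y₁ X₂ Y₂) ((β_ _ _).hom ≫ 𝓜.tensorHom X₂ Y₂ X₁ Y₁)
      (s X₁ X₂) (s Y₁ Y₂)
  s_comp_s (X Y : C) : comp0 (s X Y) (s Y X) = eId V (𝓜.tensor X Y)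
  hexagon (A B D : C) :
    comp0 (𝓜.a A B D) (comp0 (s A (𝓜.tensor B D)) (𝓜.a B D A)) =
      comp0 ((λ_ (𝟙_ V)).inv ≫ (s A B ⊗ₘ eId V D) ≫ 𝓜.tensorHom _ _ _ _)
        (comp0 (𝓜.a B A D) ((λ_ (𝟙_ V)).inv ≫ (eId V B ⊗ₘ s A D) ≫ 𝓜.tensorHom _ _ _ _))
  s_unit (A : C) : comp0 (s A 𝓜.unit) (𝓜.l A) = 𝓜.r A

end enriched

section nearly
open Bicategory

/-- The constraint data completing an action `T` on 0-, 1- and 2-cells to a pseudofunctor. -/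
structure PseudoExt {A : Type u₂} [Bicategory.{w₂, v₂} A] {B : Type u₃} [Bicategory.{w₃, v₃} B]
    (T : PrelaxFunctor A B) where
  /-- The unit constraint. -/
  mapId (a : A) : T.map (𝟙 a) ≅ 𝟙 (T.obj a)
  /-- The composition constraint. -/
  mapComp {a b c : A} (f : a ⟶ b) (g : b ⟶ c) : T.map (f ≫ g) ≅ T.map f ≫ T.map g
  map₂_whisker_left {a b c : A} (f : a ⟶ b) {g h : b ⟶ c} (η : g ⟶ h) :
    T.map₂ (f ◁ η) = (mapComp f g).hom ≫ T.map f ◁ T.map₂ η ≫ (mapComp f h).inv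
  map₂_whisker_right {a b c : A} {f g : a ⟶ b} (η : f ⟶ g) (h : b ⟶ c) :
    T.map₂ (η ▷ h) = (mapComp f h).hom ≫ T.map₂ η ▷ T.map h ≫ (mapComp g h).inv
  map₂_associator {a b c d : A} (f : a ⟶ b) (g : b ⟶ c) (h : c ⟶ d) :
    T.map₂ (Bicategory.associator f g h).hom = (mapComp (f ≫ g) h).hom ≫ (mapComp f g).hom ▷ T.map h ≫
      (Bicategory.associator (T.map f) (T.map g) (T.map h)).hom ≫ T.map f ◁ (mapComp g h).inv ≫
      (mapComp f (g ≫ h)).inv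
  map₂_left_unitor {a b : A} (f : a ⟶ b) :
    T.map₂ (Bicategory.leftUnitor f).hom = (mapComp (𝟙 a) f).hom ≫ (mapId a).hom ▷ T.map f ≫ (Bicategory.leftUnitor (T.map f)).hom
  map₂_right_unitor {a b : A} (f : a ⟶ b) :
    T.map₂ (Bicategory.rightUnitor f).hom = (mapComp f (𝟙 b)).hom ≫ T.map f ◁ (mapId b).hom ≫ (Bicategory.rightUnitor (T.map f)).hom

/-- The pseudofunctor with underlying action `T`. -/
abbrev PseudoExt.pseudo {A : Type u₂} [Bicategory.{w₂, v₂} A] {B : Type u₃}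
    [Bicategory.{w₃, v₃} B] {T : PrelaxFunctor A B} (E : PseudoExt T) : Pseudofunctor A B where
  toPrelaxFunctor := T
  mapId := E.mapId
  mapComp := E.mapComp
  map₂_whisker_left := E.map₂_whisker_left
  map₂_whisker_right := E.map₂_whisker_right
  map₂_associator := E.map₂_associator
  map₂_left_unitor := E.map₂_left_unitor
  map₂_right_unitor := E.map₂_right_unitor

/-- The product of two pseudofunctors. -/
def prodMap {A : Type u₁} [Bicategory.{w₁, v₁} A] {A' : Type u₂} [Bicategory.{w₂, v₂} A']
    {B : Type u₃} [Bicategory.{w₃, v₃} B] {B' : Type u₄} [Bicategory.{w₄, v₄} B']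
    (F : Pseudofunctor A A') (G : Pseudofunctor B B') : Pseudofunctor (A × B) (A' × B') where
  obj X := (F.obj X.1, G.obj X.2)
  map f := (F.map f.1, G.map f.2)
  map₂ η := (F.map₂ η.1, G.map₂ η.2)
  map₂_id f := Prod.ext (F.map₂_id _) (G.map₂_id _)
  map₂_comp η θ := Prod.ext (F.map₂_comp _ _) (G.map₂_comp _ _)
  mapId X := Iso.prod (F.mapId X.1) (G.mapId X.2)
  mapComp f g := Iso.prod (F.mapComp f.1 g.1) (G.mapComp f.2 g.2)
  map₂_whisker_left f _ _ η := Prod.ext (F.map₂_whisker_left _ _) (G.map₂_whisker_left _ _)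
  map₂_whisker_right η h := Prod.ext (F.map₂_whisker_right _ _) (G.map₂_whisker_right _ _)
  map₂_associator f g h := Prod.ext (F.map₂_associator _ _ _) (G.map₂_associator _ _ _)
  map₂_left_unitor f := Prod.ext (F.map₂_left_unitor _) (G.map₂_left_unitor _)
  map₂_right_unitor f := Prod.ext (F.map₂_right_unitor _) (G.map₂_right_unitor _)

/-- The rebracketing `(A × B) × C ⥤ A × (B × C)`. -/
def prodAssoc (A : Type u₁) [Bicategory.{w₁, v₁} A] (B : Type u₂) [Bicategory.{w₂, v₂} B]
    (C : Type u₃) [Bicategory.{w₃, v₃} C] : Pseudofunctor ((A × B) × C) (A × (B × C)) where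
  obj X := (X.1.1, (X.1.2, X.2))
  map f := (f.1.1, (f.1.2, f.2))
  map₂ η := (η.1.1, (η.1.2, η.2))
  map₂_id _ := rfl
  map₂_comp _ _ := rfl
  mapId _ := Iso.refl _
  mapComp _ _ := Iso.refl _
  map₂_whisker_left _ _ _ _ := by simp
  map₂_whisker_right _ _ := by simp
  map₂_associator _ _ _ := by simp
  map₂_left_unitor _ := by simp
  map₂_right_unitor _ := by simp

/-- A strong transformation is 2-natural (strict) if its naturality constraints are identities. -/
def IsStrictTrans {A : Type u₂} [Bicategory.{w₂, v₂} A] {B : Type u₃} [Bicategory.{w₃, v₃} B]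
    {F G : Pseudofunctor A B} (t : Pseudofunctor.StrongTrans F G) : Prop :=
  ∀ {a b : A} (f : a ⟶ b), ∃ h : F.map f ≫ t.app b = t.app a ≫ G.map f,
    t.naturality f = eqToIso h

/-- A 1-cell with a strict two-sided inverse. -/
def IsInvertible {B : Type u₂} [Bicategory.{w₂, v₂} B] {X Y : B} (f : X ⟶ Y) : Prop :=
  ∃ g : Y ⟶ X, f ≫ g = 𝟙 X ∧ g ≫ f = 𝟙 Y

/-- The structure of a nearly strict monoidal 2-category on the 2-category `B`, with product `T`
(on 0-, 1- and 2-cells) and unit object `J`. -/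
structure NearlyStrictMonoidal {B : Type u₂} [Bicategory.{w₂, v₂} B] [Bicategory.Strict B]
    (T : PrelaxFunctor (B × B) B) (J : B) where
  /-- The constraints making the product a pseudofunctor `B × B ⥤ B`. -/
  ext : PseudoExt T
  /-- The associator. -/
  a : Pseudofunctor.StrongTrans
    ((prodMap ext.pseudo (Pseudofunctor.id B)).comp ext.pseudo)
    ((prodAssoc B B B).comp ((prodMap (Pseudofunctor.id B) ext.pseudo).comp ext.pseudo))
  /-- The left unitor. -/
  l : Pseudofunctor.StrongTrans
    ((Bicategory.Prod.sectR J B).toPseudofunctor.comp ext.pseudo) (Pseudofunctor.id B)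
  /-- The right unitor. -/
  r : Pseudofunctor.StrongTrans
    ((Bicategory.Prod.sectL B J).toPseudofunctor.comp ext.pseudo) (Pseudofunctor.id B)
  a_strict : IsStrictTrans a
  l_strict : IsStrictTrans l
  r_strict : IsStrictTrans r
  a_inv (X Y Z : B) : IsInvertible (a.app ((X, Y), Z))
  l_inv (X : B) : IsInvertible (l.app X)
  r_inv (X : B) : IsInvertible (r.app X)
  pentagon (X Y Z Z' : B) :
    (T.map (X := (T.obj (T.obj (X, Y), Z), Z')) (Y := (T.obj (X, T.obj (Y, Z)), Z'))
        (a.app ((X, Y), Z), 𝟙 Z') ≫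
      (a.app ((X, T.obj (Y, Z)), Z') ≫
      T.map (X := (X, T.obj (T.obj (Y, Z), Z'))) (Y := (X, T.obj (Y, T.obj (Z, Z'))))
        (𝟙 X, a.app ((Y, Z), Z')) :
        T.obj (T.obj (X, T.obj (Y, Z)), Z') ⟶ T.obj (X, T.obj (Y, T.obj (Z, Z')))) :
      T.obj (T.obj (T.obj (X, Y), Z), Z') ⟶ T.obj (X, T.obj (Y, T.obj (Z, Z')))) =
    (a.app ((T.obj (X, Y), Z), Z') ≫ a.app ((X, Y), T.obj (Z, Z')) :
      T.obj (T.obj (T.obj (X, Y), Z), Z') ⟶ T.obj (X, T.obj (Y, T.obj (Z, Z'))))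
  triangle (X Y : B) :
    (a.app ((X, J), Y) ≫
      T.map (X := (X, T.obj (J, Y))) (Y := (X, Y)) (𝟙 X, l.app Y) :
      T.obj (T.obj (X, J), Y) ⟶ T.obj (X, Y)) =
    T.map (X := (T.obj (X, J), Y)) (Y := (X, Y)) (r.app X, 𝟙 Y)

/-- A symmetry on a nearly strict monoidal 2-category. -/
structure NearlyStrictSymmetry {B : Type u₂} [Bicategory.{w₂, v₂} B] [Bicategory.Strict B]
    {T : PrelaxFunctor (B × B) B} {J : B} (N : NearlyStrictMonoidal T J) where
  /-- The symmetry, natural up to invertible 2-cells. -/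
  s : Pseudofunctor.StrongTrans N.ext.pseudo
    ((Bicategory.Prod.swap B B).toPseudofunctor.comp N.ext.pseudo)
  s_comp_s (X Y : B) :
    (s.app (X, Y) ≫ s.app (Y, X) : T.obj (X, Y) ⟶ T.obj (X, Y)) = 𝟙 (T.obj (X, Y))
  hexagon (X Y Z : B) :
    (N.a.app ((X, Y), Z) ≫ (s.app (X, T.obj (Y, Z)) ≫ N.a.app ((Y, Z), X) :
        T.obj (X, T.obj (Y, Z)) ⟶ T.obj (Y, T.obj (Z, X))) :
      T.obj (T.obj (X, Y), Z) ⟶ T.obj (Y, T.obj (Z, X))) =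
    (T.map (X := (T.obj (X, Y), Z)) (Y := (T.obj (Y, X), Z)) (s.app (X, Y), 𝟙 Z) ≫
      (N.a.app ((Y, X), Z) ≫
      T.map (X := (Y, T.obj (X, Z))) (Y := (Y, T.obj (Z, X))) (𝟙 Y, s.app (X, Z)) :
        T.obj (T.obj (Y, X), Z) ⟶ T.obj (Y, T.obj (Z, X))) :
      T.obj (T.obj (X, Y), Z) ⟶ T.obj (Y, T.obj (Z, X)))
  s_unit (X : B) :
    (s.app (X, J) ≫ N.l.app X : T.obj (X, J) ⟶ X) = N.r.app X

end nearly

section para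

variable {V : Type u₁} [Category.{v₁} V] [MonoidalCategory V] [SymmetricCategory V]
  (M) (F : V ⥤ W) [F.LaxBraided] (P : ObjectProperty W) [IsStrictMonoidalSub P]

/-- The composite `V ⟶ W ⟶ Kl_M ⟶ Cat`. -/
abbrev paraFunctor : V ⥤ Cat.{v, max u v} := F ⋙ toKl M ⋙ partialSlice M P

/-- The change of base of the `V`-category `C` along `paraFunctor`, as a 2-category. -/
abbrev Para (C : Type w) [EnrichedCategory V C] :=
  CatEnriched (TransportEnrichment (paraFunctor M F P) C)

variable {C : Type w} [EnrichedCategory V C]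

/-- An object of `C` as a 0-cell. -/
def Para.of (X : C) : Para M F P C := X

variable {M F P}

/-- The 1-cell given by a Kleisli arrow `k : U ⟶ F C(X, Y)`. -/
def oneCell {X Y : C} (U : W) (hU : P U)
    (k : Kleisli.mk M U ⟶ (toKl M).obj (F.obj (X ⟶[V] Y))) :
    Para.of M F P X ⟶ Para.of M F P Y :=
  CostructuredArrow.mk (S := (klSub M P).ι)
    (Y := (⟨Kleisli.mk M U, hU⟩ : (klSub M P).FullSubcategory)) k

/-- The parameter space of a 1-cell. -/
def param {X Y : C} (f : Para.of M F P X ⟶ Para.of M F P Y) : W :=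
  (CostructuredArrow.left (S := (klSub M P).ι) (T := (toKl M).obj (F.obj (X ⟶[V] Y))) f).obj.of

theorem param_mem {X Y : C} (f : Para.of M F P X ⟶ Para.of M F P Y) : P (param f) :=
  (CostructuredArrow.left (S := (klSub M P).ι) (T := (toKl M).obj (F.obj (X ⟶[V] Y))) f).property

/-- The Kleisli arrow of a 1-cell. -/
def arrow {X Y : C} (f : Para.of M F P X ⟶ Para.of M F P Y) :
    Kleisli.mk M (param f) ⟶ (toKl M).obj (F.obj (X ⟶[V] Y)) :=
  CostructuredArrow.hom (S := (klSub M P).ι) (T := (toKl M).obj (F.obj (X ⟶[V] Y))) f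

/-- The reparametrization underlying a 2-cell. -/
def repar {X Y : C} {f g : Para.of M F P X ⟶ Para.of M F P Y} (φ : f ⟶ g) :
    Kleisli.mk M (param f) ⟶ Kleisli.mk M (param g) :=
  (CommaMorphism.left (L := (klSub M P).ι)
    (R := Functor.fromPUnit.{0} ((toKl M).obj (F.obj (X ⟶[V] Y)))) φ).hom

/-- The binary operation `(k₁ ⊗ k₂) ⨾ L_M(c)` on Kleisli arrows, where `c : A ⊗ B ⟶ D` in `W` and
`L_M(c) = c ⨾ η`. -/
def liftOp {U₁ U₂ A B D : W} (k₁ : Kleisli.mk M U₁ ⟶ (toKl M).obj A)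
    (k₂ : Kleisli.mk M U₂ ⟶ (toKl M).obj B) (c : A ⊗ B ⟶ D) :
    Kleisli.mk M (U₁ ⊗ U₂) ⟶ (toKl M).obj D :=
  MonoidalCategoryStruct.tensorHom k₁ k₂ ≫ (toKl M).map c

/-- The 1-cell `F_ε ⨾ F(p) ⨾ η` with parameter space `I` given by a point `p : I ⟶ C(X, Y)`. -/
def liftPt {X Y : C} (p : 𝟙_ V ⟶ (X ⟶[V] Y)) : Para.of M F P X ⟶ Para.of M F P Y :=
  oneCell (𝟙_ W) P.prop_unit ((toKl M).map (ε F ≫ F.map p))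

variable (M F P) in
/-- The product on 0-, 1- and 2-cells induced by a monoidal structure on the `V`-category `C`:
on hom-categories it is the functor `N C(X₁, Y₁) × N C(X₂, Y₂) ⟶ N (C(X₁, Y₁) ⊗ C(X₂, Y₂)) ⟶
N C(X₁ ⊠ X₂, Y₁ ⊠ Y₂)` for `N = paraFunctor M F P`. -/
def paraTensor (𝓜 : MonoidalVCat V C) :
    PrelaxFunctor (Para M F P C × Para M F P C) (Para M F P C) where
  obj X := Para.of M F P (𝓜.tensor X.1 X.2)
  map {X Y} f := (μ (paraFunctor M F P) _ _ ≫
    (paraFunctor M F P).map (𝓜.tensorHom X.1 Y.1 X.2 Y.2)).toFunctor.obj f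
  map₂ {X Y} _ _ η := (μ (paraFunctor M F P) _ _ ≫
    (paraFunctor M F P).map (𝓜.tensorHom X.1 Y.1 X.2 Y.2)).toFunctor.map η
  map₂_id {X Y} f := (μ (paraFunctor M F P) _ _ ≫
    (paraFunctor M F P).map (𝓜.tensorHom X.1 Y.1 X.2 Y.2)).toFunctor.map_id f
  map₂_comp {X Y} _ _ _ η θ := (μ (paraFunctor M F P) _ _ ≫
    (paraFunctor M F P).map (𝓜.tensorHom X.1 Y.1 X.2 Y.2)).toFunctor.map_comp η θ

end para

end ParaUncertainty

open ParaUncertainty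

/-! Write `G = F ⋙ toKl M`, a lax symmetric monoidal functor from `V` to the Kleisli category. A
1-cell is a generalized element `U ⟶ G C(X, Y)` with `U` in the subcategory, and both horizontal
composition and `⊠` are instances of one operation `laxOp`: tensor two generalized elements, apply
the comparison of `G`, then apply `G` to an arrow of `V`. Identities and coherence 1-cells are
points (`laxPt`).

Two principles reduce everything to the Kleisli category. A 2-cell is determined by its
reparametrization (`repar_injective`), so each equation of 2-cells is an equation between arrows of
parameter spaces. Two 1-cells are equal if their arrows agree along an equality of parameter spaces
(`oneCell_ext`). On the subcategory, associators and unitors are such equalities, so the structural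
2-cells of the strict 2-category may be exchanged for the coherence isomorphisms of the Kleisli
category (`repar_associator` and its analogues for unitors).

The tensorator comes from `laxOp_interchange`: functoriality of `⊠` in `V` passes through `G` at the
price of a middle-four interchange of parameters. The pseudofunctor axioms are then the coherence
laws of the interchange, which is involutive by symmetry.

The map `liftPt` respects composition, identities and `⊠`, so pentagon, triangle, hexagon and
invertibility are inherited from the underlying category of `C`. A `V`-naturality square gives a
2-cell `ρ ⨾ τ ⨾ λ⁻¹`, with `τ` the associator, a unitor or the braiding of the parameter spaces
(`arrow_comp_liftPt`). In the first two cases it is an equality, so `a`, `l`, `r` are 2-natural; the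
braiding need not be one, so `s` is only pseudonatural. -/

namespace ParaUncertainty

/-! ### Coherence in symmetric monoidal categories -/

section coherence

variable {K : Type u} [Category.{v} K]

/-- The arrow `e` is an identity up to an equality of its endpoints. -/
def IsEqToHom {X Y : K} (e : X ⟶ Y) : Prop := ∃ h : X = Y, e = eqToHom h

theorem IsEqToHom.comp {X Y Z : K} {e : X ⟶ Y} {e' : Y ⟶ Z} (h : IsEqToHom e)
    (h' : IsEqToHom e') : IsEqToHom (e ≫ e') := by
  obtain ⟨rfl, rfl⟩ := h
  obtain ⟨rfl, rfl⟩ := h'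
  exact ⟨rfl, by simp⟩

theorem IsEqToHom.inv {X Y : K} {e : X ≅ Y} (h : IsEqToHom e.hom) : IsEqToHom e.inv := by
  obtain ⟨rfl, h⟩ := h
  exact ⟨rfl, (Iso.inv_eq_inv e (Iso.refl X)).2 h⟩

variable [MonoidalCategory K]

/-- The composition axiom of a transformation whose constraints are `ρ ⨾ t ⨾ λ⁻¹`. -/
theorem unitConj_comp {A B A' B' D D' : K} {tA : A ⟶ A'} {tB : B ⟶ B'} {t : D ⟶ D'}
    {m : D ⟶ A ⊗ B} {m' : D' ⟶ A' ⊗ B'} (h : t ≫ m' = m ≫ (tA ⊗ₘ tB)) :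
    ((ρ_ D).hom ≫ t ≫ (λ_ D').inv) ≫ 𝟙_ K ◁ m' =
      m ▷ 𝟙_ K ≫ (α_ A B (𝟙_ K)).hom ≫ A ◁ ((ρ_ B).hom ≫ tB ≫ (λ_ B').inv) ≫
        (α_ A (𝟙_ K) B').inv ≫ ((ρ_ A).hom ≫ tA ≫ (λ_ A').inv) ▷ B' ≫
          (α_ (𝟙_ K) A' B').hom := by
  -- The unitors slide past `m'` and expose `t ≫ m'`, to which `h` applies. Expanding `tA ⊗ₘ tB`
  -- with `tB` first matches the order on the right-hand side; the rest is pure coherence.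
  have h1 : ((ρ_ D).hom ≫ t ≫ (λ_ D').inv) ≫ 𝟙_ K ◁ m' =
      (ρ_ D).hom ≫ (t ≫ m') ≫ (λ_ (A' ⊗ B')).inv := by simp
  rw [h1, h, tensorHom_def']
  simp only [MonoidalCategory.whiskerLeft_comp, comp_whiskerRight, Category.assoc]
  monoidal

/-- The unit axiom of a transformation whose constraints are `ρ ⨾ t ⨾ λ⁻¹`. -/
theorem unitConj_id {A A' : K} {t : A ⟶ A'} {i : A ⟶ 𝟙_ K} {i' : A' ⟶ 𝟙_ K} (h : t ≫ i' = i) :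
    ((ρ_ A).hom ≫ t ≫ (λ_ A').inv) ≫ 𝟙_ K ◁ i' =
      i ▷ 𝟙_ K ≫ (λ_ (𝟙_ K)).hom ≫ (ρ_ (𝟙_ K)).inv := by
  subst h
  simp [unitors_equal, unitors_inv_equal]

/-- Naturality of the constraints `ρ ⨾ t ⨾ λ⁻¹`. -/
theorem unitConj_natural {A A' B B' : K} {t : A ⟶ A'} {t' : B ⟶ B'} {x : A ⟶ B} {x' : A' ⟶ B'}
    (h : x ≫ t' = t ≫ x') :
    x ▷ 𝟙_ K ≫ (ρ_ B).hom ≫ t' ≫ (λ_ B').inv =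
      ((ρ_ A).hom ≫ t ≫ (λ_ A').inv) ≫ 𝟙_ K ◁ x' := by
  rw [rightUnitor_naturality_assoc, ← Category.assoc x, h]
  simp

variable [SymmetricCategory K]

/-- The inverse interchange uses the inverse braiding, which symmetry identifies with the braiding.
Hence the tensorator and its inverse are both interchanges. -/
theorem tensorμ_eq_tensorδ (X₁ X₂ Y₁ Y₂ : K) : tensorμ X₁ Y₁ X₂ Y₂ = tensorδ X₁ X₂ Y₁ Y₂ := by
  simp only [tensorμ, tensorδ, SymmetricCategory.braiding_swap_eq_inv_braiding X₂ Y₁]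

theorem tensorμ_tensorμ (X₁ X₂ Y₁ Y₂ : K) :
    tensorμ X₁ X₂ Y₁ Y₂ ≫ tensorμ X₁ Y₁ X₂ Y₂ = 𝟙 _ := by
  rw [tensorμ_eq_tensorδ X₁ X₂ Y₁ Y₂, tensorμ_tensorδ]

theorem tensorμ_tensorμ_assoc (X₁ X₂ Y₁ Y₂ : K) {Z : K} (h : (X₁ ⊗ X₂) ⊗ (Y₁ ⊗ Y₂) ⟶ Z) :
    tensorμ X₁ X₂ Y₁ Y₂ ≫ tensorμ X₁ Y₁ X₂ Y₂ ≫ h = h := by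
  rw [← Category.assoc, tensorμ_tensorμ, Category.id_comp]

/-- The large braiding undoes the crossing of `X₂` and `Y₁` made by the interchange, which leaves
the same three crossings on both sides. -/
theorem tensorμ_braiding (X₁ X₂ Y₁ Y₂ : K) :
    tensorμ X₁ X₂ Y₁ Y₂ ≫ (β_ (X₁ ⊗ Y₁) (X₂ ⊗ Y₂)).hom =
      ((β_ X₁ X₂).hom ⊗ₘ (β_ Y₁ Y₂).hom) ≫ tensorμ X₂ X₁ Y₂ Y₁ := by
  simp [tensorμ, SymmetricCategory.braiding_swap_eq_inv_braiding X₂ Y₁,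
    MonoidalCategory.tensorHom_def]

/-- Naturality of the interchange followed by its involutivity; the shape is that of the whiskering
axiom of a pseudofunctor. -/
theorem whiskerLeft_tensorHom_whiskerLeft {A₁ B₁ A₂ B₂ : K} (U₁ U₂ : K) (x₁ : A₁ ⟶ B₁)
    (x₂ : A₂ ⟶ B₂) : (U₁ ◁ x₁ ⊗ₘ U₂ ◁ x₂) =
      tensorμ U₁ A₁ U₂ A₂ ≫ (U₁ ⊗ U₂) ◁ (x₁ ⊗ₘ x₂) ≫ tensorμ U₁ U₂ B₁ B₂ := by
  rw [tensorμ_natural_right, tensorμ_tensorμ_assoc]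

theorem whiskerRight_tensorHom_whiskerRight {A₁ B₁ A₂ B₂ : K} (x₁ : A₁ ⟶ B₁)
    (x₂ : A₂ ⟶ B₂) (U₁ U₂ : K) : (x₁ ▷ U₁ ⊗ₘ x₂ ▷ U₂) =
      tensorμ A₁ U₁ A₂ U₂ ≫ (x₁ ⊗ₘ x₂) ▷ (U₁ ⊗ U₂) ≫ tensorμ B₁ B₂ U₁ U₂ := by
  rw [tensorμ_natural_left, tensorμ_tensorμ_assoc]

/-- This is `associator_monoidal` with two interchanges moved to the other side by involutivity, the
form of `map₂_associator`. -/
theorem associator_tensorHom_associator (X₁ Y₁ Z₁ X₂ Y₂ Z₂ : K) :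
    ((α_ X₁ Y₁ Z₁).hom ⊗ₘ (α_ X₂ Y₂ Z₂).hom) =
      tensorμ (X₁ ⊗ Y₁) Z₁ (X₂ ⊗ Y₂) Z₂ ≫ tensorμ X₁ Y₁ X₂ Y₂ ▷ (Z₁ ⊗ Z₂) ≫
        (α_ (X₁ ⊗ X₂) (Y₁ ⊗ Y₂) (Z₁ ⊗ Z₂)).hom ≫ (X₁ ⊗ X₂) ◁ tensorμ Y₁ Y₂ Z₁ Z₂ ≫
          tensorμ X₁ X₂ (Y₁ ⊗ Z₁) (Y₂ ⊗ Z₂) := by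
  have h := associator_monoidal X₁ Y₁ Z₁ X₂ Y₂ Z₂
  have h' := congrArg (· ≫ (X₁ ⊗ X₂) ◁ tensorμ Y₁ Y₂ Z₁ Z₂ ≫
    tensorμ X₁ X₂ (Y₁ ⊗ Z₁) (Y₂ ⊗ Z₂)) h
  simp only [Category.assoc] at h'
  rw [h', ← MonoidalCategory.whiskerLeft_comp_assoc, tensorμ_tensorμ,
    MonoidalCategory.whiskerLeft_id, Category.id_comp, tensorμ_tensorμ, Category.comp_id]

theorem braiding_tensorμ (X₁ Y₁ X₂ Y₂ : K) :
    (β_ (X₁ ⊗ Y₁) (X₂ ⊗ Y₂)).hom ≫ (𝟙 _ ⊗ₘ 𝟙 _) ≫ tensorμ X₂ Y₂ X₁ Y₁ =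
      tensorμ X₁ Y₁ X₂ Y₂ ≫ ((β_ X₁ X₂).hom ⊗ₘ (β_ Y₁ Y₂).hom) := by
  have h := congrArg (tensorμ X₁ Y₁ X₂ Y₂ ≫ · ≫ tensorμ X₂ Y₂ X₁ Y₁)
    (tensorμ_braiding X₁ X₂ Y₁ Y₂)
  simpa [tensorμ_tensorμ, tensorμ_tensorμ_assoc] using h

/-- The composition axiom for the associator. The identity factors are the trivial constraints of
`prodAssoc` and of the identity pseudofunctors, kept so that the statement matches definitionally.
-/
theorem associator_tensorμ (X₁ X₂ Y₁ Y₂ Z₁ Z₂ : K) :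
    (α_ (X₁ ⊗ X₂) (Y₁ ⊗ Y₂) (Z₁ ⊗ Z₂)).hom ≫ (𝟙 _ ⊗ₘ (𝟙 _ ⊗ₘ 𝟙 _)) ≫
        (𝟙 _ ⊗ₘ tensorμ Y₁ Y₂ Z₁ Z₂) ≫ tensorμ X₁ X₂ (Y₁ ⊗ Z₁) (Y₂ ⊗ Z₂) =
      ((tensorμ X₁ X₂ Y₁ Y₂ ⊗ₘ 𝟙 _) ≫ tensorμ (X₁ ⊗ Y₁) (X₂ ⊗ Y₂) Z₁ Z₂) ≫
        ((α_ X₁ Y₁ Z₁).hom ⊗ₘ (α_ X₂ Y₂ Z₂).hom) := by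
  rw [id_tensorHom_id, id_tensorHom_id, tensorHom_id, id_tensorHom, Category.id_comp,
    Category.assoc, tensor_associativity]

/-- The composition axiom for the left unitor; the factor `(ρ_ (𝟙_ K)).inv` is the constraint
comparing the identity of the unit object with its own composite. -/
theorem leftUnitor_tensorμ (X Y : K) :
    (λ_ (X ⊗ Y)).hom ≫ 𝟙 _ =
      (((ρ_ (𝟙_ K)).inv ⊗ₘ 𝟙 _) ≫ tensorμ (𝟙_ K) (𝟙_ K) X Y) ≫ ((λ_ X).hom ⊗ₘ (λ_ Y).hom) := by
  rw [Category.comp_id, tensor_left_unitality, tensorHom_id, unitors_inv_equal, Category.assoc]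

theorem rightUnitor_tensorμ (X Y : K) :
    (ρ_ (X ⊗ Y)).hom ≫ 𝟙 _ =
      ((𝟙 _ ⊗ₘ (λ_ (𝟙_ K)).inv) ≫ tensorμ X Y (𝟙_ K) (𝟙_ K)) ≫ ((ρ_ X).hom ⊗ₘ (ρ_ Y).hom) := by
  rw [Category.comp_id, tensor_right_unitality, id_tensorHom, Category.assoc]

/-- This and the next three lemmas are unit axioms. All parameter spaces are built from the unit
object, where the two unitors coincide. -/
theorem associator_unit :
    (α_ (𝟙_ K) (𝟙_ K) (𝟙_ K)).hom ≫ (𝟙 _ ⊗ₘ (𝟙 _ ⊗ₘ 𝟙 _)) ≫ (𝟙 _ ⊗ₘ (λ_ (𝟙_ K)).hom) ≫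
      (λ_ (𝟙_ K)).hom = ((λ_ (𝟙_ K)).hom ⊗ₘ 𝟙 _) ≫ (λ_ (𝟙_ K)).hom := by
  simp [unitors_equal]

theorem leftUnitor_unit :
    (λ_ (𝟙_ K)).hom ≫ 𝟙 _ = (𝟙 _ ⊗ₘ 𝟙 _) ≫ (λ_ (𝟙_ K)).hom := by
  simp

theorem rightUnitor_unit :
    (ρ_ (𝟙_ K)).hom ≫ 𝟙 _ = (𝟙 _ ⊗ₘ 𝟙 _) ≫ (λ_ (𝟙_ K)).hom := by
  simp [unitors_equal]

theorem braiding_unit :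
    (β_ (𝟙_ K) (𝟙_ K)).hom ≫ (𝟙 _ ⊗ₘ 𝟙 _) ≫ (λ_ (𝟙_ K)).hom = (λ_ (𝟙_ K)).hom := by
  rw [id_tensorHom_id, Category.id_comp, braiding_leftUnitor, unitors_equal]

end coherence

/-! ### Operations on generalized elements of a lax symmetric monoidal functor -/

section laxOperations

variable {V : Type u₁} [Category.{v₁} V] [MonoidalCategory V] [SymmetricCategory V]
  {K : Type u} [Category.{v} K] [MonoidalCategory K] [SymmetricCategory K]
  (G : V ⥤ K) [G.LaxBraided]

/-- The binary operation on generalized elements of `G A` and `G B` induced by `m : A ⊗ B ⟶ D`. -/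
def laxOp {U₁ U₂ : K} {A B D : V} (k₁ : U₁ ⟶ G.obj A) (k₂ : U₂ ⟶ G.obj B) (m : A ⊗ B ⟶ D) :
    U₁ ⊗ U₂ ⟶ G.obj D :=
  (k₁ ⊗ₘ k₂) ≫ μ G A B ≫ G.map m

/-- The point of `G D` induced by a point of `D`. -/
def laxPt {D : V} (p : 𝟙_ V ⟶ D) : 𝟙_ K ⟶ G.obj D := ε G ≫ G.map p

/-- Unitality of `G` absorbs the point, so a binary operation with a point in one slot becomes a
unary operation from `V`, up to a unitor of the parameter space. -/
theorem laxOp_laxPt_left {U : K} {A B D : V} (p : 𝟙_ V ⟶ A) (k : U ⟶ G.obj B) (m : A ⊗ B ⟶ D) :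
    laxOp G (laxPt G p) k m = (λ_ U).hom ≫ k ≫ G.map ((λ_ B).inv ≫ p ▷ B ≫ m) := by
  rw [laxOp, laxPt, MonoidalCategory.tensorHom_def', comp_whiskerRight]
  simp only [Category.assoc, μ_natural_left_assoc]
  rw [← leftUnitor_naturality_assoc, left_unitality]
  simp only [Category.assoc, ← Functor.map_comp]
  simp

theorem laxOp_laxPt_right {U : K} {A B D : V} (k : U ⟶ G.obj A) (p : 𝟙_ V ⟶ B) (m : A ⊗ B ⟶ D) :
    laxOp G k (laxPt G p) m = (ρ_ U).hom ≫ k ≫ G.map ((ρ_ A).inv ≫ A ◁ p ≫ m) := by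
  rw [laxOp, laxPt, MonoidalCategory.tensorHom_def, MonoidalCategory.whiskerLeft_comp]
  simp only [Category.assoc, μ_natural_right_assoc]
  rw [← rightUnitor_naturality_assoc, right_unitality]
  simp only [Category.assoc, ← Functor.map_comp]
  simp

theorem laxOp_laxPt_laxPt {A B D : V} (p : 𝟙_ V ⟶ A) (q : 𝟙_ V ⟶ B) (m : A ⊗ B ⟶ D) :
    laxOp G (laxPt G p) (laxPt G q) m =
      (λ_ (𝟙_ K)).hom ≫ laxPt G ((λ_ (𝟙_ V)).inv ≫ (p ⊗ₘ q) ≫ m) := by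
  rw [laxOp_laxPt_left, laxPt, laxPt, Category.assoc, ← Functor.map_comp,
    MonoidalCategory.tensorHom_def']
  simp

theorem laxOp_eq_map {U₁ U₂ : K} {A B D : V} (k₁ : U₁ ⟶ G.obj A) (k₂ : U₂ ⟶ G.obj B)
    (m : A ⊗ B ⟶ D) : laxOp G k₁ k₂ m = laxOp G k₁ k₂ (𝟙 _) ≫ G.map m := by
  simp [laxOp]

theorem eq_comp_map_id {U : K} {A : V} (k : U ⟶ G.obj A) : k = k ≫ G.map (𝟙 A) := by
  simp

theorem laxOp_braiding {U₁ U₂ : K} {A B D : V} (k₁ : U₁ ⟶ G.obj A) (k₂ : U₂ ⟶ G.obj B)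
    (m : B ⊗ A ⟶ D) :
    (β_ U₁ U₂).hom ≫ laxOp G k₂ k₁ m =
      laxOp G k₁ k₂ (𝟙 _) ≫ G.map ((β_ A B).hom ≫ m) := by
  rw [← laxOp_eq_map]
  symm
  simp only [laxOp, Functor.map_comp]
  rw [← BraidedCategory.braiding_naturality_assoc, ← Category.assoc (μ G A B),
    Functor.LaxBraided.braided, Category.assoc]

/-- Naturality of the comparison gathers all operations of `V` in one `G.map`. Both bracketings thus
refer to the same triple of elements, and identities in `V` can be applied. -/
theorem laxOp_laxOp_left {U₁ U₂ U₃ : K} {A B D E Z : V} (k₁ : U₁ ⟶ G.obj A) (k₂ : U₂ ⟶ G.obj B)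
    (k₃ : U₃ ⟶ G.obj D) (m : A ⊗ B ⟶ E) (n : E ⊗ D ⟶ Z) :
    laxOp G (laxOp G k₁ k₂ m) k₃ n =
      laxOp G (laxOp G k₁ k₂ (𝟙 _)) k₃ (𝟙 _) ≫ G.map (m ▷ D ≫ n) := by
  rw [← laxOp_eq_map, laxOp, laxOp, laxOp, laxOp, Functor.map_comp, ← μ_natural_left_assoc]
  simp only [MonoidalCategory.tensorHom_def, comp_whiskerRight, Category.assoc,
    CategoryTheory.Functor.map_id, id_whiskerRight, Category.id_comp, whisker_exchange_assoc]

/-- The other bracketing reaches the same normal form by associativity of `G`, which trades the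
associator of parameter spaces for that of `V`. -/
theorem laxOp_laxOp_right {U₁ U₂ U₃ : K} {A B D E Z : V} (k₁ : U₁ ⟶ G.obj A) (k₂ : U₂ ⟶ G.obj B)
    (k₃ : U₃ ⟶ G.obj D) (m : B ⊗ D ⟶ E) (n : A ⊗ E ⟶ Z) :
    (α_ U₁ U₂ U₃).hom ≫ laxOp G k₁ (laxOp G k₂ k₃ m) n =
      laxOp G (laxOp G k₁ k₂ (𝟙 _)) k₃ (𝟙 _) ≫ G.map ((α_ A B D).hom ≫ A ◁ m ≫ n) := by
  have h1 : k₁ ⊗ₘ ((k₂ ⊗ₘ k₃) ≫ μ G B D ≫ G.map m) =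
      (k₁ ⊗ₘ (k₂ ⊗ₘ k₃)) ≫ _ ◁ μ G B D ≫ _ ◁ G.map m := by
    simp [MonoidalCategory.tensorHom_def]
  have h2 : ((k₁ ⊗ₘ k₂) ≫ μ G A B ≫ G.map (𝟙 _)) ⊗ₘ k₃ =
      ((k₁ ⊗ₘ k₂) ⊗ₘ k₃) ≫ μ G A B ▷ _ := by
    simp [MonoidalCategory.tensorHom_def']
  rw [← laxOp_eq_map, laxOp, laxOp, laxOp, laxOp, h1, h2, Functor.map_comp,
    Functor.map_comp, Category.assoc,
    Category.assoc, Category.assoc, μ_natural_right_assoc, ← associator_naturality_assoc,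
    ← associativity_assoc]

theorem laxOp_interchange {U₁ V₁ U₂ V₂ : K} {A₁ B₁ A₂ B₂ D₁ D₂ E₁ E₂ Z : V}
    (k₁ : U₁ ⟶ G.obj A₁) (l₁ : V₁ ⟶ G.obj B₁) (k₂ : U₂ ⟶ G.obj A₂) (l₂ : V₂ ⟶ G.obj B₂)
    {c₁ : A₁ ⊗ B₁ ⟶ D₁} {c₂ : A₂ ⊗ B₂ ⟶ D₂} {t : D₁ ⊗ D₂ ⟶ Z}
    {t₁ : A₁ ⊗ A₂ ⟶ E₁} {t₂ : B₁ ⊗ B₂ ⟶ E₂} {c : E₁ ⊗ E₂ ⟶ Z}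
    (h : tensorμ A₁ B₁ A₂ B₂ ≫ (t₁ ⊗ₘ t₂) ≫ c = (c₁ ⊗ₘ c₂) ≫ t) :
    laxOp G (laxOp G k₁ l₁ c₁) (laxOp G k₂ l₂ c₂) t =
      tensorμ U₁ V₁ U₂ V₂ ≫ laxOp G (laxOp G k₁ k₂ t₁) (laxOp G l₁ l₂ t₂) c := by
  -- In this normal form `h` applies inside a single `G.map`; what then remains is that the
  -- comparison of a lax braided functor commutes with the interchange.
  have key {X₁ Y₁ X₂ Y₂ : K} {P₁ Q₁ P₂ Q₂ R₁ R₂ S : V} (x₁ : X₁ ⟶ G.obj P₁) (y₁ : Y₁ ⟶ G.obj Q₁)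
      (x₂ : X₂ ⟶ G.obj P₂) (y₂ : Y₂ ⟶ G.obj Q₂) (a : P₁ ⊗ Q₁ ⟶ R₁) (b : P₂ ⊗ Q₂ ⟶ R₂)
      (d : R₁ ⊗ R₂ ⟶ S) : laxOp G (laxOp G x₁ y₁ a) (laxOp G x₂ y₂ b) d =
      ((x₁ ⊗ₘ y₁) ⊗ₘ (x₂ ⊗ₘ y₂)) ≫ (μ G P₁ Q₁ ⊗ₘ μ G P₂ Q₂) ≫ μ G _ _ ≫
        G.map ((a ⊗ₘ b) ≫ d) := by
    rw [laxOp, laxOp, laxOp, Functor.map_comp, ← μ_natural_assoc]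
    simp only [tensorHom_comp_tensorHom_assoc]
  rw [key, key, ← h, Functor.map_comp, ← tensorμ_natural_assoc]
  congr 1
  simpa using (tensorμ_comp_μ_tensorHom_μ_comp_μ_assoc G A₁ B₁ A₂ B₂
    (G.map ((t₁ ⊗ₘ t₂) ≫ c))).symm

end laxOperations

/-! ### The cells of the change of base as Kleisli arrows -/

section cells

variable {V : Type u₁} [Category.{v₁} V] [MonoidalCategory V] [SymmetricCategory V]
  {W : Type u} [Category.{v} W] [MonoidalCategory W] [SymmetricCategory W]
  {M : Monad W} [M.toFunctor.LaxBraided] [NatTrans.IsMonoidal M.η] [NatTrans.IsMonoidal M.μ]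
  {F : V ⥤ W} [F.LaxBraided] {P : ObjectProperty W} [IsStrictMonoidalSub P]
  {C : Type w} [EnrichedCategory V C]

theorem liftOp_eq_laxOp {U₁ U₂ : W} {A B D : V} (k₁ : Kleisli.mk M U₁ ⟶ (toKl M).obj (F.obj A))
    (k₂ : Kleisli.mk M U₂ ⟶ (toKl M).obj (F.obj B)) (m : A ⊗ B ⟶ D) :
    liftOp k₁ k₂ (μ F A B ≫ F.map m) = laxOp (F ⋙ toKl M) k₁ k₂ m := by
  have h : μ (F ⋙ toKl M) A B = (toKl M).map (μ F A B) := Category.id_comp _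
  rw [laxOp, h, liftOp, (toKl M).map_comp]
  rfl

/-- Since `toKl M` is lax braided with identity comparisons, its compatibility with the interchange
reduces to this equality. -/
theorem toKl_tensorμ (X₁ X₂ Y₁ Y₂ : W) :
    (toKl M).map (tensorμ X₁ X₂ Y₁ Y₂) =
      tensorμ (Kleisli.mk M X₁) (Kleisli.mk M X₂) (Kleisli.mk M Y₁) (Kleisli.mk M Y₂) := by
  have h := tensorμ_comp_μ_tensorHom_μ_comp_μ (toKl M) X₁ X₂ Y₁ Y₂
  have e (A B A' B' : W) :
      (μ (toKl M) A B ⊗ₘ μ (toKl M) A' B') ≫ μ (toKl M) (A ⊗ B) (A' ⊗ B') = 𝟙 _ :=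
    (Category.comp_id _).trans (id_tensorHom_id _ _)
  rw [e, ← Category.assoc, e] at h
  exact ((Category.id_comp _).symm.trans h.symm).trans (Category.comp_id _)

theorem arrow_comp {X Y Z : C} (f : Para.of M F P X ⟶ Para.of M F P Y)
    (g : Para.of M F P Y ⟶ Para.of M F P Z) :
    arrow (f ≫ g) = laxOp (F ⋙ toKl M) (arrow f) (arrow g) (eComp V X Y Z) := by
  -- Unfolding the transported composition: the identity is the comparison of `toKl M`, sandwiched
  -- between those of the slice functor and of `F`.
  have h : arrow (f ≫ g) = (((arrow f ⊗ₘ arrow g) ≫ 𝟙 _) ≫ (toKl M).map (μ F _ _)) ≫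
    (toKl M).map (F.map (eComp V X Y Z)) := rfl
  rw [← liftOp_eq_laxOp, h, liftOp, Category.comp_id, Category.assoc, (toKl M).map_comp]

theorem repar_injective {X Y : C} {f g : Para.of M F P X ⟶ Para.of M F P Y} :
    Function.Injective (fun φ : f ⟶ g => repar φ) := fun φ ψ h =>
  CostructuredArrow.hom_ext _ _ (ObjectProperty.hom_ext _ h)

/-- Parallel arrows that are both transports along equalities coincide. This lets an equality 2-cell
be computed as any such arrow of parameter spaces. -/
theorem repar_eqToHom {X Y : C} {f g : Para.of M F P X ⟶ Para.of M F P Y} (h : f = g)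
    {e : Kleisli.mk M (param f) ⟶ Kleisli.mk M (param g)} (he : IsEqToHom e) :
    repar (eqToHom h) = e := by
  subst h
  exact he.choose_spec.symm

theorem repar_w {X Y : C} {f g : Para.of M F P X ⟶ Para.of M F P Y} (φ : f ⟶ g) :
    arrow f = repar φ ≫ arrow g := (CostructuredArrow.w φ).symm

/-- The 2-cell with underlying reparametrization `φ`. -/
def twoCell {X Y : C} {f g : Para.of M F P X ⟶ Para.of M F P Y}
    (φ : Kleisli.mk M (param f) ⟶ Kleisli.mk M (param g)) (h : arrow f = φ ≫ arrow g) : f ⟶ g :=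
  CostructuredArrow.homMk (S := (klSub M P).ι) (T := (toKl M).obj (F.obj (X ⟶[V] Y)))
   (ObjectProperty.homMk φ) h.symm

/-- The invertible 2-cell with underlying reparametrization `φ`. -/
def twoIso {X Y : C} {f g : Para.of M F P X ⟶ Para.of M F P Y}
    (φ : Kleisli.mk M (param f) ≅ Kleisli.mk M (param g)) (h : arrow f = φ.hom ≫ arrow g) :
    f ≅ g where
  hom := twoCell φ.hom h
  inv := twoCell φ.inv (by rw [h, Iso.inv_hom_id_assoc])
  hom_inv_id := repar_injective φ.hom_inv_id
  inv_hom_id := repar_injective φ.inv_hom_id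

/-- A 1-cell is a parameter space together with an arrow, so equality needs a transport along the
equality of spaces; `e` is that transport, usually a unitor. -/
theorem oneCell_ext {X Y : C} {f g : Para.of M F P X ⟶ Para.of M F P Y}
    (e : Kleisli.mk M (param f) ⟶ Kleisli.mk M (param g)) (he : IsEqToHom e)
    (h : arrow f = e ≫ arrow g) : f = g := by
  have key (A B : (klSub M P).FullSubcategory) (h : A = B) (h' : A.obj = B.obj) :
      (eqToHom h).hom = eqToHom h' := by
    subst h; rfl
  have ho (A B : (klSub M P).FullSubcategory) (h : A.obj = B.obj) : A = B := by
    cases A; cases B; cases h; rfl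
  have hl := ho (CostructuredArrow.left (S := (klSub M P).ι) f)
    (CostructuredArrow.left (S := (klSub M P).ι) g) he.choose
  refine CostructuredArrow.obj_ext (S := (klSub M P).ι) _ _ hl (Eq.trans ?_ h.symm)
  exact congrArg (· ≫ arrow g) ((key _ _ hl he.choose).trans he.choose_spec.symm)

theorem isEqToHom_associator {X Y Z : W} (hX : P X) (hY : P Y) (hZ : P Z) :
    IsEqToHom (α_ (Kleisli.mk M X) (Kleisli.mk M Y) (Kleisli.mk M Z)).hom :=
  kl_assoc M P _ _ _ hX hY hZ

theorem isEqToHom_leftUnitor {X : W} (hX : P X) : IsEqToHom (λ_ (Kleisli.mk M X)).hom :=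
  kl_left M P _ hX

theorem isEqToHom_rightUnitor {X : W} (hX : P X) : IsEqToHom (ρ_ (Kleisli.mk M X)).hom :=
  kl_right M P _ hX

/-- The structural 2-cell is an equality 2-cell, and on the subcategory the Kleisli associator is a
transport along an equality as well. -/
theorem repar_associator {X Y Z T : C} (f : Para.of M F P X ⟶ Para.of M F P Y)
    (g : Para.of M F P Y ⟶ Para.of M F P Z) (h : Para.of M F P Z ⟶ Para.of M F P T) :
    repar (Bicategory.associator f g h).hom =
      (α_ (Kleisli.mk M (param f)) (Kleisli.mk M (param g)) (Kleisli.mk M (param h))).hom :=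
  repar_eqToHom (Category.assoc f g h)
    (isEqToHom_associator (param_mem f) (param_mem g) (param_mem h))

theorem repar_associator_inv {X Y Z T : C} (f : Para.of M F P X ⟶ Para.of M F P Y)
    (g : Para.of M F P Y ⟶ Para.of M F P Z) (h : Para.of M F P Z ⟶ Para.of M F P T) :
    repar (Bicategory.associator f g h).inv =
      (α_ (Kleisli.mk M (param f)) (Kleisli.mk M (param g)) (Kleisli.mk M (param h))).inv :=
  repar_eqToHom (Category.assoc f g h).symm
    (isEqToHom_associator (param_mem f) (param_mem g) (param_mem h)).inv

theorem repar_leftUnitor {X Y : C} (f : Para.of M F P X ⟶ Para.of M F P Y) :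
    repar (Bicategory.leftUnitor f).hom = (λ_ (Kleisli.mk M (param f))).hom :=
  repar_eqToHom (Category.id_comp f) (isEqToHom_leftUnitor (param_mem f))

theorem repar_leftUnitor_inv {X Y : C} (f : Para.of M F P X ⟶ Para.of M F P Y) :
    repar (Bicategory.leftUnitor f).inv = (λ_ (Kleisli.mk M (param f))).inv :=
  repar_eqToHom (Category.id_comp f).symm (isEqToHom_leftUnitor (param_mem f)).inv

theorem repar_rightUnitor {X Y : C} (f : Para.of M F P X ⟶ Para.of M F P Y) :
    repar (Bicategory.rightUnitor f).hom = (ρ_ (Kleisli.mk M (param f))).hom :=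
  repar_eqToHom (Category.comp_id f) (isEqToHom_rightUnitor (param_mem f))

theorem repar_rightUnitor_inv {X Y : C} (f : Para.of M F P X ⟶ Para.of M F P Y) :
    repar (Bicategory.rightUnitor f).inv = (ρ_ (Kleisli.mk M (param f))).inv :=
  repar_eqToHom (Category.comp_id f).symm (isEqToHom_rightUnitor (param_mem f)).inv

theorem arrow_liftPt {X Y : C} (p : 𝟙_ V ⟶ (X ⟶[V] Y)) :
    arrow (liftPt p : Para.of M F P X ⟶ Para.of M F P Y) = laxPt (F ⋙ toKl M) p := by
  have h : ε (F ⋙ toKl M) = (toKl M).map (ε F) := Category.id_comp _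
  rw [laxPt, h]
  exact (toKl M).map_comp _ _

theorem arrow_id (X : C) : arrow (𝟙 (Para.of M F P X)) = laxPt (F ⋙ toKl M) (eId V X) := by
  have h : arrow (𝟙 (Para.of M F P X)) = ((𝟙 _ ≫ 𝟙 _) ≫ (toKl M).map (ε F)) ≫
    (toKl M).map (F.map (eId V X)) := rfl
  rw [h, Category.comp_id, Category.id_comp, ← (toKl M).map_comp]
  exact arrow_liftPt (P := P) (eId V X)

theorem id_eq_liftPt (X : C) : 𝟙 (Para.of M F P X) = liftPt (eId V X) :=
  oneCell_ext (𝟙 _) ⟨rfl, rfl⟩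
    (((arrow_id X).trans (arrow_liftPt (P := P) (eId V X)).symm).trans (Category.id_comp _).symm)

/-- The product of two 1-cells. -/
abbrev tensor₁ (𝓜 : MonoidalVCat V C) {X₁ Y₁ X₂ Y₂ : C} (f₁ : Para.of M F P X₁ ⟶ Para.of M F P Y₁)
    (f₂ : Para.of M F P X₂ ⟶ Para.of M F P Y₂) :
    Para.of M F P (𝓜.tensor X₁ X₂) ⟶ Para.of M F P (𝓜.tensor Y₁ Y₂) :=
  (paraTensor M F P 𝓜).map (X := (Para.of M F P X₁, Para.of M F P X₂))
    (Y := (Para.of M F P Y₁, Para.of M F P Y₂)) (f₁, f₂)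

theorem arrow_tensor₁ (𝓜 : MonoidalVCat V C) {X₁ Y₁ X₂ Y₂ : C}
    (f₁ : Para.of M F P X₁ ⟶ Para.of M F P Y₁) (f₂ : Para.of M F P X₂ ⟶ Para.of M F P Y₂) :
    arrow (tensor₁ 𝓜 f₁ f₂) =
      laxOp (F ⋙ toKl M) (arrow f₁) (arrow f₂) (𝓜.tensorHom X₁ Y₁ X₂ Y₂) := by
  have h : arrow (tensor₁ 𝓜 f₁ f₂) = (((arrow f₁ ⊗ₘ arrow f₂) ≫ 𝟙 _) ≫ (toKl M).map (μ F _ _)) ≫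
    (toKl M).map (F.map (𝓜.tensorHom X₁ Y₁ X₂ Y₂)) := rfl
  rw [← liftOp_eq_laxOp, h, liftOp, Category.comp_id, Category.assoc, (toKl M).map_comp]

end cells
-- Lifting points of the hom-objects
section points

variable {V : Type u₁} [Category.{v₁} V] [MonoidalCategory V] [SymmetricCategory V]
  {W : Type u} [Category.{v} W] [MonoidalCategory W] [SymmetricCategory W]
  {M : Monad W} [M.toFunctor.LaxBraided] [NatTrans.IsMonoidal M.η] [NatTrans.IsMonoidal M.μ]
  {F : V ⥤ W} [F.LaxBraided] {P : ObjectProperty W} [IsStrictMonoidalSub P]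
  {C : Type w} [EnrichedCategory V C]
-- The composite has parameter space `I ⊗ I`, which equals `I` along the unitor, so lifting
-- preserves composition strictly.
theorem liftPt_comp_liftPt {X Y Z : C} (p : 𝟙_ V ⟶ (X ⟶[V] Y)) (q : 𝟙_ V ⟶ (Y ⟶[V] Z)) :
    (liftPt p : Para.of M F P X ⟶ Para.of M F P Y) ≫
      (liftPt q : Para.of M F P Y ⟶ Para.of M F P Z) = liftPt (comp0 p q) := by
  refine oneCell_ext (λ_ (𝟙_ (Kleisli M))).hom (isEqToHom_leftUnitor P.prop_unit) ?_
  rw [arrow_comp, arrow_liftPt, arrow_liftPt, arrow_liftPt]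
  exact laxOp_laxPt_laxPt _ p q _

theorem tensor₁_liftPt (𝓜 : MonoidalVCat V C) {X₁ Y₁ X₂ Y₂ : C} (p : 𝟙_ V ⟶ (X₁ ⟶[V] Y₁))
    (q : 𝟙_ V ⟶ (X₂ ⟶[V] Y₂)) :
    tensor₁ 𝓜 (liftPt p : Para.of M F P X₁ ⟶ Para.of M F P Y₁)
      (liftPt q : Para.of M F P X₂ ⟶ Para.of M F P Y₂) =
      liftPt ((λ_ (𝟙_ V)).inv ≫ (p ⊗ₘ q) ≫ 𝓜.tensorHom X₁ Y₁ X₂ Y₂) := by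
  refine oneCell_ext (λ_ (𝟙_ (Kleisli M))).hom (isEqToHom_leftUnitor P.prop_unit) ?_
  rw [arrow_tensor₁, arrow_liftPt, arrow_liftPt, arrow_liftPt]
  exact laxOp_laxPt_laxPt _ p q _

theorem liftPt_isInvertible {X Y : C} {p : 𝟙_ V ⟶ (X ⟶[V] Y)} (h : IsIso0 p) :
    IsInvertible (liftPt p : Para.of M F P X ⟶ Para.of M F P Y) := by
  obtain ⟨q, h₁, h₂⟩ := h
  exact ⟨liftPt q, by rw [liftPt_comp_liftPt, h₁, id_eq_liftPt],
    by rw [liftPt_comp_liftPt, h₂, id_eq_liftPt]⟩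

/-- A `V`-naturality square induces a naturality square of 1-cells. -/
theorem arrow_comp_liftPt {X X' Y Y' : C} {D : V} {Φ : D ⟶ (X ⟶[V] Y)} {Ψ : D ⟶ (X' ⟶[V] Y')}
    {t : 𝟙_ V ⟶ (X ⟶[V] X')} {t' : 𝟙_ V ⟶ (Y ⟶[V] Y')} (h : VNaturalAt Φ Ψ t t')
    {f : Para.of M F P X ⟶ Para.of M F P Y} {g : Para.of M F P X' ⟶ Para.of M F P Y'}
    (k : Kleisli.mk M (param f) ⟶ (F ⋙ toKl M).obj D)
    (τ : Kleisli.mk M (param f) ⟶ Kleisli.mk M (param g))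
    (hf : arrow f = k ≫ (F ⋙ toKl M).map Φ) (hg : τ ≫ arrow g = k ≫ (F ⋙ toKl M).map Ψ) :
    arrow (f ≫ (liftPt t' : Para.of M F P Y ⟶ Para.of M F P Y')) =
      ((ρ_ _).hom ≫ τ ≫ (λ_ _).inv) ≫
        arrow ((liftPt t : Para.of M F P X ⟶ Para.of M F P X') ≫ g) := by
  -- The square is rewritten with the points whiskered in, since this is how `laxOp_laxPt_left` and
  -- `laxOp_laxPt_right` present composition with a point. Those lemmas also produce the outer `ρ`
  -- and `λ⁻¹`.
  have h₁ : Φ ≫ (ρ_ _).inv ≫ _ ◁ t' ≫ eComp V X Y Y' =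
      Ψ ≫ (λ_ _).inv ≫ t ▷ _ ≫ eComp V X X' Y' := by
    have := h.symm
    rw [MonoidalCategory.tensorHom_def, MonoidalCategory.tensorHom_def'] at this
    simpa using this
  rw [arrow_comp, arrow_comp, arrow_liftPt, arrow_liftPt]
  refine (laxOp_laxPt_right _ _ _ _).trans (Eq.trans ?_
    (congrArg (_ ≫ ·) (laxOp_laxPt_left (F ⋙ toKl M) t (arrow g) (eComp V X X' Y')).symm))
  rw [hf, Category.assoc, Category.assoc, Category.assoc, Iso.inv_hom_id_assoc,
    ← Category.assoc τ, hg, Category.assoc, ← Functor.map_comp, ← Functor.map_comp, h₁]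

end points

/-! ### Naturality squares and interchange of 1-cells -/

section naturality

variable {V : Type u₁} [Category.{v₁} V] [MonoidalCategory V] [SymmetricCategory V]
  {W : Type u} [Category.{v} W] [MonoidalCategory W] [SymmetricCategory W]
  {M : Monad W} [M.toFunctor.LaxBraided] [NatTrans.IsMonoidal M.η] [NatTrans.IsMonoidal M.μ]
  {F : V ⥤ W} [F.LaxBraided] {P : ObjectProperty W} [IsStrictMonoidalSub P]
  {C : Type w} [EnrichedCategory V C]
variable (𝓜 : MonoidalVCat V C)

theorem arrow_associator_natural {X₁ Y₁ X₂ Y₂ X₃ Y₃ : C}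
    (f₁ : Para.of M F P X₁ ⟶ Para.of M F P Y₁) (f₂ : Para.of M F P X₂ ⟶ Para.of M F P Y₂)
    (f₃ : Para.of M F P X₃ ⟶ Para.of M F P Y₃) :
    arrow (tensor₁ 𝓜 (tensor₁ 𝓜 f₁ f₂) f₃ ≫ liftPt (𝓜.a Y₁ Y₂ Y₃)) =
      ((ρ_ ((Kleisli.mk M (param f₁) ⊗ Kleisli.mk M (param f₂)) ⊗ Kleisli.mk M (param f₃))).hom ≫
        (α_ _ _ _).hom ≫ (λ_ _).inv) ≫
        arrow (liftPt (𝓜.a X₁ X₂ X₃) ≫ tensor₁ 𝓜 f₁ (tensor₁ 𝓜 f₂ f₃)) := by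
  refine arrow_comp_liftPt (𝓜.a_natural X₁ Y₁ X₂ Y₂ X₃ Y₃)
    (f := tensor₁ 𝓜 (tensor₁ 𝓜 f₁ f₂) f₃) (g := tensor₁ 𝓜 f₁ (tensor₁ 𝓜 f₂ f₃))
    -- The triple of generalized elements before any operation of `V`, common to both bracketings.
    (laxOp _ (laxOp _ (arrow f₁) (arrow f₂) (𝟙 _)) (arrow f₃) (𝟙 _))
    (α_ (Kleisli.mk M (param f₁)) (Kleisli.mk M (param f₂)) (Kleisli.mk M (param f₃))).hom ?_ ?_
  · refine (arrow_tensor₁ 𝓜 (tensor₁ 𝓜 f₁ f₂) f₃).trans (Eq.trans ?_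
      (laxOp_laxOp_left (F ⋙ toKl M) (arrow f₁) (arrow f₂) (arrow f₃) _ _))
    exact congrArg (laxOp (F ⋙ toKl M) · (arrow f₃) _) (arrow_tensor₁ 𝓜 f₁ f₂)
  · refine Eq.trans ?_ (laxOp_laxOp_right (F ⋙ toKl M) (arrow f₁) (arrow f₂) (arrow f₃) _ _)
    refine congrArg (_ ≫ ·) ((arrow_tensor₁ 𝓜 f₁ (tensor₁ 𝓜 f₂ f₃)).trans ?_)
    exact congrArg (laxOp (F ⋙ toKl M) (arrow f₁) · _) (arrow_tensor₁ 𝓜 f₂ f₃)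

theorem arrow_leftUnitor_natural {X Y : C} (f : Para.of M F P X ⟶ Para.of M F P Y) :
    arrow (tensor₁ 𝓜 (𝟙 (Para.of M F P 𝓜.unit)) f ≫ liftPt (𝓜.l Y)) =
      ((ρ_ (𝟙_ (Kleisli M) ⊗ Kleisli.mk M (param f))).hom ≫ (λ_ _).hom ≫ (λ_ _).inv) ≫
        arrow (liftPt (𝓜.l X) ≫ f) := by
  refine arrow_comp_liftPt (𝓜.l_natural X Y)
    (f := tensor₁ 𝓜 (𝟙 (Para.of M F P 𝓜.unit)) f) (g := f)
    -- The identity of the unit object is a point, so only its unitor survives in the parameters.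
    ((λ_ (Kleisli.mk M (param f))).hom ≫ arrow f) (λ_ (Kleisli.mk M (param f))).hom ?_ ?_
  · refine (arrow_tensor₁ 𝓜 (𝟙 (Para.of M F P 𝓜.unit)) f).trans
      ((congrArg (laxOp (F ⋙ toKl M) · (arrow f) _) (arrow_id 𝓜.unit)).trans ?_)
    exact (laxOp_laxPt_left _ _ _ _).trans (Category.assoc _ _ _).symm
  · exact eq_comp_map_id (F ⋙ toKl M) _

theorem arrow_rightUnitor_natural {X Y : C} (f : Para.of M F P X ⟶ Para.of M F P Y) :
    arrow (tensor₁ 𝓜 f (𝟙 (Para.of M F P 𝓜.unit)) ≫ liftPt (𝓜.r Y)) =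
      ((ρ_ (Kleisli.mk M (param f) ⊗ 𝟙_ (Kleisli M))).hom ≫ (ρ_ _).hom ≫ (λ_ _).inv) ≫
        arrow (liftPt (𝓜.r X) ≫ f) := by
  refine arrow_comp_liftPt (𝓜.r_natural X Y)
    (f := tensor₁ 𝓜 f (𝟙 (Para.of M F P 𝓜.unit))) (g := f)
    ((ρ_ (Kleisli.mk M (param f))).hom ≫ arrow f) (ρ_ (Kleisli.mk M (param f))).hom ?_ ?_
  · refine (arrow_tensor₁ 𝓜 f (𝟙 (Para.of M F P 𝓜.unit))).trans
      ((congrArg (laxOp (F ⋙ toKl M) (arrow f) · _) (arrow_id 𝓜.unit)).trans ?_)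
    exact (laxOp_laxPt_right _ _ _ _).trans (Category.assoc _ _ _).symm
  · exact eq_comp_map_id (F ⋙ toKl M) _

theorem arrow_symmetry_natural {𝓜 : MonoidalVCat V C} (𝓢 : SymmetryVCat 𝓜) {X₁ Y₁ X₂ Y₂ : C}
    (f₁ : Para.of M F P X₁ ⟶ Para.of M F P Y₁) (f₂ : Para.of M F P X₂ ⟶ Para.of M F P Y₂) :
    arrow (tensor₁ 𝓜 f₁ f₂ ≫ liftPt (𝓢.s Y₁ Y₂)) =
      ((ρ_ (Kleisli.mk M (param f₁) ⊗ Kleisli.mk M (param f₂))).hom ≫ (β_ _ _).hom ≫ (λ_ _).inv) ≫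
        arrow (liftPt (𝓢.s X₁ X₂) ≫ tensor₁ 𝓜 f₂ f₁) := by
  refine arrow_comp_liftPt (𝓢.s_natural X₁ Y₁ X₂ Y₂)
    (f := tensor₁ 𝓜 f₁ f₂) (g := tensor₁ 𝓜 f₂ f₁) (laxOp _ (arrow f₁) (arrow f₂) (𝟙 _))
    (β_ (Kleisli.mk M (param f₁)) (Kleisli.mk M (param f₂))).hom ?_ ?_
  · exact (arrow_tensor₁ 𝓜 f₁ f₂).trans (laxOp_eq_map _ _ _ _)
  · exact (congrArg (_ ≫ ·) (arrow_tensor₁ 𝓜 f₂ f₁)).trans (laxOp_braiding _ _ _ _)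

/-- Functoriality of `⊠` on hom-objects, carried through `G` by `laxOp_interchange`; this makes the
interchange of parameters a 2-cell. -/
theorem arrow_interchange {X₁ Y₁ Z₁ X₂ Y₂ Z₂ : C}
    (f₁ : Para.of M F P X₁ ⟶ Para.of M F P Y₁) (f₂ : Para.of M F P X₂ ⟶ Para.of M F P Y₂)
    (g₁ : Para.of M F P Y₁ ⟶ Para.of M F P Z₁) (g₂ : Para.of M F P Y₂ ⟶ Para.of M F P Z₂) :
    arrow (tensor₁ 𝓜 (f₁ ≫ g₁) (f₂ ≫ g₂)) =
      tensorμ (Kleisli.mk M (param f₁)) (Kleisli.mk M (param g₁)) (Kleisli.mk M (param f₂))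
        (Kleisli.mk M (param g₂)) ≫ arrow (tensor₁ 𝓜 f₁ f₂ ≫ tensor₁ 𝓜 g₁ g₂) := by
  rw [arrow_comp, arrow_tensor₁, arrow_tensor₁, arrow_tensor₁, arrow_comp, arrow_comp]
  exact laxOp_interchange _ _ _ _ _ (𝓜.tensorHom_comp X₁ Y₁ Z₁ X₂ Y₂ Z₂)

theorem arrow_tensor₁_id (X₁ X₂ : C) :
    arrow (tensor₁ 𝓜 (𝟙 (Para.of M F P X₁)) (𝟙 (Para.of M F P X₂))) =
      (λ_ (𝟙_ (Kleisli M))).hom ≫ arrow (𝟙 (Para.of M F P (𝓜.tensor X₁ X₂))) := by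
  rw [arrow_tensor₁, arrow_id, arrow_id, arrow_id, ← 𝓜.tensorHom_id]
  exact laxOp_laxPt_laxPt _ _ _ _

end naturality
-- Axioms on coherence 1-cells and the product pseudofunctor
section tensorConstraints

variable {V : Type u₁} [Category.{v₁} V] [MonoidalCategory V] [SymmetricCategory V]
  {W : Type u} [Category.{v} W] [MonoidalCategory W] [SymmetricCategory W]
  {M : Monad W} [M.toFunctor.LaxBraided] [NatTrans.IsMonoidal M.η] [NatTrans.IsMonoidal M.μ]
  {F : V ⥤ W} [F.LaxBraided] {P : ObjectProperty W} [IsStrictMonoidalSub P]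
  {C : Type w} [EnrichedCategory V C]
variable (𝓜 : MonoidalVCat V C)

/-- Every 1-cell involved, including identities, is a lifted point, so the equation is the image
under `liftPt` of the pentagon in `C`. The triangle, symmetry and hexagon are treated alike. -/
theorem pentagon_liftPt (X Y Z T : C) :
    tensor₁ 𝓜 (liftPt (𝓜.a X Y Z)) (𝟙 (Para.of M F P T)) ≫ liftPt (𝓜.a X (𝓜.tensor Y Z) T) ≫
      tensor₁ 𝓜 (𝟙 (Para.of M F P X)) (liftPt (𝓜.a Y Z T)) =
    liftPt (𝓜.a (𝓜.tensor X Y) Z T) ≫ liftPt (𝓜.a X Y (𝓜.tensor Z T)) := by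
  rw [id_eq_liftPt, id_eq_liftPt, tensor₁_liftPt, tensor₁_liftPt, liftPt_comp_liftPt,
    liftPt_comp_liftPt, liftPt_comp_liftPt, 𝓜.pentagon]

theorem triangle_liftPt (X Y : C) :
    liftPt (𝓜.a X 𝓜.unit Y) ≫ tensor₁ 𝓜 (𝟙 (Para.of M F P X)) (liftPt (𝓜.l Y)) =
      tensor₁ 𝓜 (liftPt (𝓜.r X)) (𝟙 (Para.of M F P Y)) := by
  rw [id_eq_liftPt, id_eq_liftPt, tensor₁_liftPt, tensor₁_liftPt, liftPt_comp_liftPt, 𝓜.triangle]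

theorem symmetry_liftPt {𝓜 : MonoidalVCat V C} (𝓢 : SymmetryVCat 𝓜) (X Y : C) :
    (liftPt (𝓢.s X Y) ≫ liftPt (𝓢.s Y X) :
      Para.of M F P (𝓜.tensor X Y) ⟶ Para.of M F P (𝓜.tensor X Y)) = 𝟙 _ := by
  rw [liftPt_comp_liftPt, 𝓢.s_comp_s, id_eq_liftPt]

theorem symmetry_unit_liftPt {𝓜 : MonoidalVCat V C} (𝓢 : SymmetryVCat 𝓜) (X : C) :
    (liftPt (𝓢.s X 𝓜.unit) : Para.of M F P (𝓜.tensor X 𝓜.unit) ⟶ _) ≫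
      (liftPt (𝓜.l X) : _ ⟶ Para.of M F P X) = liftPt (𝓜.r X) := by
  rw [liftPt_comp_liftPt, 𝓢.s_unit]

theorem hexagon_liftPt {𝓜 : MonoidalVCat V C} (𝓢 : SymmetryVCat 𝓜) (X Y Z : C) :
    liftPt (𝓜.a X Y Z) ≫ liftPt (𝓢.s X (𝓜.tensor Y Z)) ≫ liftPt (𝓜.a Y Z X) =
    tensor₁ 𝓜 (liftPt (𝓢.s X Y)) (𝟙 (Para.of M F P Z)) ≫ liftPt (𝓜.a Y X Z) ≫
      tensor₁ 𝓜 (𝟙 (Para.of M F P Y)) (liftPt (𝓢.s X Z)) := by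
  rw [id_eq_liftPt, id_eq_liftPt, tensor₁_liftPt, tensor₁_liftPt, liftPt_comp_liftPt,
    liftPt_comp_liftPt, liftPt_comp_liftPt, liftPt_comp_liftPt, 𝓢.hexagon]

/-- The composition constraint of the product: the inverse of the tensorator. -/
def tensorComp {X₁ Y₁ Z₁ X₂ Y₂ Z₂ : C}
    (f₁ : Para.of M F P X₁ ⟶ Para.of M F P Y₁) (f₂ : Para.of M F P X₂ ⟶ Para.of M F P Y₂)
    (g₁ : Para.of M F P Y₁ ⟶ Para.of M F P Z₁) (g₂ : Para.of M F P Y₂ ⟶ Para.of M F P Z₂) :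
    tensor₁ 𝓜 (f₁ ≫ g₁) (f₂ ≫ g₂) ≅ tensor₁ 𝓜 f₁ f₂ ≫ tensor₁ 𝓜 g₁ g₂ :=
  twoIso ⟨tensorμ (Kleisli.mk M (param f₁)) (Kleisli.mk M (param g₁)) (Kleisli.mk M (param f₂))
        (Kleisli.mk M (param g₂)), tensorμ (Kleisli.mk M (param f₁)) (Kleisli.mk M (param f₂))
        (Kleisli.mk M (param g₁)) (Kleisli.mk M (param g₂)), tensorμ_tensorμ _ _ _ _,
        tensorμ_tensorμ _ _ _ _⟩ (arrow_interchange 𝓜 f₁ f₂ g₁ g₂)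

/-- The unit constraint of the product. -/
def tensorId (X₁ X₂ : C) :
    tensor₁ 𝓜 (𝟙 (Para.of M F P X₁)) (𝟙 (Para.of M F P X₂)) ≅
      𝟙 (Para.of M F P (𝓜.tensor X₁ X₂)) :=
  twoIso (λ_ (𝟙_ (Kleisli M))) (arrow_tensor₁_id 𝓜 X₁ X₂)

variable (M F P) in
/-- The constraints making the product a pseudofunctor. -/
def tensorExt : PseudoExt (paraTensor M F P 𝓜) where
  mapId X := tensorId 𝓜 X.1 X.2
  mapComp f g := tensorComp 𝓜 f.1 f.2 g.1 g.2
  map₂_whisker_left f _ _ η := repar_injective (C := C) (whiskerLeft_tensorHom_whiskerLeft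
    (Kleisli.mk M (param (C := C) f.1)) (Kleisli.mk M (param (C := C) f.2))
    (repar (C := C) η.1) (repar (C := C) η.2))
  map₂_whisker_right η h := repar_injective (C := C) (whiskerRight_tensorHom_whiskerRight
    (repar (C := C) η.1) (repar (C := C) η.2) (Kleisli.mk M (param (C := C) h.1))
    (Kleisli.mk M (param (C := C) h.2)))
  -- The associators of the 2-category are replaced by those of the Kleisli category on both sides,
  -- which reduces the axiom to coherence of the interchange. The unitor axioms follow the same
  -- pattern.
  map₂_associator f g h := repar_injective (C := C) (by
    refine (congrArg₂ (fun x y => MonoidalCategoryStruct.tensorHom x y)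
      (repar_associator (C := C) f.1 g.1 h.1) (repar_associator (C := C) f.2 g.2 h.2)).trans
        ((associator_tensorHom_associator _ _ _ _ _ _).trans ?_)
    exact congrArg (fun x =>
      tensorμ (Kleisli.mk M (param (C := C) f.1) ⊗ Kleisli.mk M (param (C := C) g.1)) _ _ _ ≫
      tensorμ _ _ _ _ ▷ _ ≫ x ≫ _ ◁ tensorμ _ _ _ _ ≫ tensorμ _ _ _ _)
      (repar_associator (C := C) (tensor₁ (C := C) 𝓜 f.1 f.2) (tensor₁ (C := C) 𝓜 g.1 g.2)
        (tensor₁ (C := C) 𝓜 h.1 h.2)).symm)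
  map₂_left_unitor f := repar_injective (C := C) (by
    refine (congrArg₂ (fun x y => MonoidalCategoryStruct.tensorHom x y)
      (repar_leftUnitor (C := C) f.1) (repar_leftUnitor (C := C) f.2)).trans
        ((leftUnitor_monoidal _ _).trans ?_)
    exact congrArg (fun x => tensorμ (𝟙_ (Kleisli M)) _ _ _ ≫ (λ_ (𝟙_ (Kleisli M))).hom ▷ _ ≫ x)
      (repar_leftUnitor (C := C) (tensor₁ (C := C) 𝓜 f.1 f.2)).symm)
  map₂_right_unitor f := repar_injective (C := C) (by
    refine (congrArg₂ (fun x y => MonoidalCategoryStruct.tensorHom x y)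
      (repar_rightUnitor (C := C) f.1) (repar_rightUnitor (C := C) f.2)).trans
        ((rightUnitor_monoidal _ _).trans ?_)
    exact congrArg (fun x => tensorμ _ (𝟙_ (Kleisli M)) _ _ ≫ _ ◁ (λ_ (𝟙_ (Kleisli M))).hom ≫ x)
      (repar_rightUnitor (C := C) (tensor₁ (C := C) 𝓜 f.1 f.2)).symm)

end tensorConstraints
-- Strong transformations from families of points
section transformations

variable {V : Type u₁} [Category.{v₁} V] [MonoidalCategory V] [SymmetricCategory V]
  {W : Type u} [Category.{v} W] [MonoidalCategory W] [SymmetricCategory W]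
  {M : Monad W} [M.toFunctor.LaxBraided] [NatTrans.IsMonoidal M.η] [NatTrans.IsMonoidal M.μ]
  {F : V ⥤ W} [F.LaxBraided] {P : ObjectProperty W} [IsStrictMonoidalSub P]
  {C : Type w} [EnrichedCategory V C]
/-- The hypotheses under which a family of points of `C` underlies a strong transformation with
naturality constraints `ρ ⨾ τ ⨾ λ⁻¹`. -/
structure PointTrans {A : Type u₂} [Bicategory.{w₂, v₂} A] (Φ Ψ : Pseudofunctor A (Para M F P C))
    where
  /-- The points. -/
  pt (a : A) : 𝟙_ V ⟶ EnrichedCategory.Hom (V := V) (C := C) (Φ.obj a) (Ψ.obj a)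
  /-- The comparison of parameter spaces. -/
  τ {a b : A} (f : a ⟶ b) :
    Kleisli.mk M (param (C := C) (Φ.map f)) ≅ Kleisli.mk M (param (C := C) (Ψ.map f))
  w {a b : A} (f : a ⟶ b) :
    arrow (C := C) (Φ.map f ≫ liftPt (C := C) (X := Φ.obj b) (Y := Ψ.obj b) (pt b)) =
      ((ρ_ _).hom ≫ (τ f).hom ≫ (λ_ _).inv) ≫
        arrow (C := C) (liftPt (C := C) (X := Φ.obj a) (Y := Ψ.obj a) (pt a) ≫ Ψ.map f)
  natural {a b : A} {f g : a ⟶ b} (η : f ⟶ g) :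
    repar (C := C) (Φ.map₂ η) ≫ (τ g).hom = (τ f).hom ≫ repar (C := C) (Ψ.map₂ η)
  unit (a : A) : (τ (𝟙 a)).hom ≫ repar (C := C) (Ψ.mapId a).hom = repar (C := C) (Φ.mapId a).hom
  comp {a b c : A} (f : a ⟶ b) (g : b ⟶ c) :
    (τ (f ≫ g)).hom ≫ repar (C := C) (Ψ.mapComp f g).hom =
      repar (C := C) (Φ.mapComp f g).hom ≫ ((τ f).hom ⊗ₘ (τ g).hom)

namespace PointTrans

variable {A : Type u₂} [Bicategory.{w₂, v₂} A] {Φ Ψ : Pseudofunctor A (Para M F P C)}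

/-- The strong transformation with the given points as components. -/
def trans (t : PointTrans Φ Ψ) : Pseudofunctor.StrongTrans Φ Ψ where
  app a := liftPt (C := C) (t.pt a)
  naturality f := twoIso (C := C) (ρ_ _ ≪≫ t.τ f ≪≫ (λ_ _).symm) (t.w f)
  naturality_naturality η := repar_injective (C := C) (unitConj_natural (t.natural η))
  naturality_id a := repar_injective (C := C) (by
    refine (unitConj_id (t.unit a)).trans ?_
    exact congrArg₂ (fun x y => _ ▷ _ ≫ x ≫ y)
      (repar_leftUnitor (C := C) (liftPt (C := C) (t.pt a))).symm
      (repar_rightUnitor_inv (C := C) (liftPt (C := C) (t.pt a))).symm)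
  -- `unitConj_comp` is stated with Kleisli associators; the equality 2-cells of the axiom are
  -- matched to them one by one.
  naturality_comp f g := repar_injective (C := C) (by
    refine (unitConj_comp (t.comp f g)).trans ?_
    exact congr (congr (congrArg (fun x y z => _ ▷ _ ≫ x ≫ _ ◁ _ ≫ y ≫ _ ▷ _ ≫ z)
      (repar_associator (C := C) (Φ.map f) (Φ.map g) (liftPt (C := C) (t.pt _))).symm)
      (repar_associator_inv (C := C) (Φ.map f) (liftPt (C := C) (t.pt _)) (Ψ.map g)).symm)
      (repar_associator (C := C) (liftPt (C := C) (t.pt _)) (Ψ.map f) (Ψ.map g)).symm)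

theorem isStrictTrans (t : PointTrans Φ Ψ)
    (h : ∀ {a b : A} (f : a ⟶ b), IsEqToHom (t.τ f).hom) : IsStrictTrans t.trans := fun f => by
  -- When `τ` is a transport along an equality, so is `ρ ⨾ τ ⨾ λ⁻¹`; hence the two 1-cells are equal
  -- and the constraint is the equality 2-cell.
  have he := (isEqToHom_rightUnitor (param_mem (C := C) (Φ.map f))).comp ((h f).comp
    (isEqToHom_leftUnitor (param_mem (C := C) (Ψ.map f))).inv)
  have e := oneCell_ext (C := C) _ he (t.w f)
  exact ⟨e, Iso.ext (repar_injective (C := C) (repar_eqToHom (C := C) e he).symm)⟩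

end PointTrans

end transformations
-- The monoidal structure and the symmetry
section monoidal

variable {V : Type u₁} [Category.{v₁} V] [MonoidalCategory V] [SymmetricCategory V]
  {W : Type u} [Category.{v} W] [MonoidalCategory W] [SymmetricCategory W]
  {M : Monad W} [M.toFunctor.LaxBraided] [NatTrans.IsMonoidal M.η] [NatTrans.IsMonoidal M.μ]
  {F : V ⥤ W} [F.LaxBraided] {P : ObjectProperty W} [IsStrictMonoidalSub P]
  {C : Type w} [EnrichedCategory V C]
variable (M F P) (𝓜 : MonoidalVCat V C)

/-- The points underlying the associator. -/
def associatorPoints : PointTrans (C := C)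
    ((prodMap (tensorExt M F P 𝓜).pseudo (Pseudofunctor.id _)).comp (tensorExt M F P 𝓜).pseudo)
    ((prodAssoc _ _ _).comp ((prodMap (Pseudofunctor.id _) (tensorExt M F P 𝓜).pseudo).comp
      (tensorExt M F P 𝓜).pseudo)) where
  pt X := 𝓜.a X.1.1 X.1.2 X.2
  τ f := α_ (Kleisli.mk M (param (C := C) f.1.1)) (Kleisli.mk M (param (C := C) f.1.2))
    (Kleisli.mk M (param (C := C) f.2))
  w f := arrow_associator_natural 𝓜 f.1.1 f.1.2 f.2
  natural η := associator_naturality (repar (C := C) η.1.1) (repar (C := C) η.1.2)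
    (repar (C := C) η.2)
  unit X := associator_unit
  comp f g := associator_tensorμ (Kleisli.mk M (param (C := C) f.1.1))
    (Kleisli.mk M (param (C := C) g.1.1)) (Kleisli.mk M (param (C := C) f.1.2))
    (Kleisli.mk M (param (C := C) g.1.2)) (Kleisli.mk M (param (C := C) f.2))
    (Kleisli.mk M (param (C := C) g.2))

/-- The points underlying the left unitor. -/
def leftUnitorPoints : PointTrans (C := C)
    ((Bicategory.Prod.sectR (Para.of M F P 𝓜.unit) _).toPseudofunctor.comp
      (tensorExt M F P 𝓜).pseudo) (Pseudofunctor.id _) where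
  pt X := 𝓜.l X
  τ f := λ_ (Kleisli.mk M (param (C := C) f))
  w f := arrow_leftUnitor_natural 𝓜 f
  natural η := leftUnitor_naturality (repar (C := C) η)
  unit X := leftUnitor_unit
  -- The constraint of the section pseudofunctor at the unit object is an inverse unitor of the
  -- 2-category; it is exchanged for the Kleisli one.
  comp f g := (leftUnitor_tensorμ (Kleisli.mk M (param (C := C) f))
    (Kleisli.mk M (param (C := C) g))).trans (congrArg (fun x => ((x ⊗ₘ 𝟙 _) ≫ _) ≫ _)
      (repar_rightUnitor_inv (𝟙 (Para.of M F P 𝓜.unit))).symm)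

/-- The points underlying the right unitor. -/
def rightUnitorPoints : PointTrans (C := C)
    ((Bicategory.Prod.sectL _ (Para.of M F P 𝓜.unit)).toPseudofunctor.comp
      (tensorExt M F P 𝓜).pseudo) (Pseudofunctor.id _) where
  pt X := 𝓜.r X
  τ f := ρ_ (Kleisli.mk M (param (C := C) f))
  w f := arrow_rightUnitor_natural 𝓜 f
  natural η := rightUnitor_naturality (repar (C := C) η)
  unit X := rightUnitor_unit
  comp f g := (rightUnitor_tensorμ (Kleisli.mk M (param (C := C) f))
    (Kleisli.mk M (param (C := C) g))).trans (congrArg (fun x => ((𝟙 _ ⊗ₘ x) ≫ _) ≫ _)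
      (repar_leftUnitor_inv (𝟙 (Para.of M F P 𝓜.unit))).symm)

/-- The nearly strict monoidal structure. -/
def paraMonoidal : NearlyStrictMonoidal (paraTensor M F P 𝓜) (Para.of M F P 𝓜.unit) where
  ext := tensorExt M F P 𝓜
  a := (associatorPoints M F P 𝓜).trans
  l := (leftUnitorPoints M F P 𝓜).trans
  r := (rightUnitorPoints M F P 𝓜).trans
  a_strict := (associatorPoints M F P 𝓜).isStrictTrans fun f =>
    isEqToHom_associator (param_mem (C := C) f.1.1) (param_mem (C := C) f.1.2)
      (param_mem (C := C) f.2)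
  l_strict := (leftUnitorPoints M F P 𝓜).isStrictTrans fun f =>
    isEqToHom_leftUnitor (param_mem (C := C) f)
  r_strict := (rightUnitorPoints M F P 𝓜).isStrictTrans fun f =>
    isEqToHom_rightUnitor (param_mem (C := C) f)
  a_inv X Y Z := liftPt_isInvertible (C := C) (𝓜.a_iso X Y Z)
  l_inv X := liftPt_isInvertible (C := C) (𝓜.l_iso X)
  r_inv X := liftPt_isInvertible (C := C) (𝓜.r_iso X)
  pentagon X Y Z T := pentagon_liftPt 𝓜 X Y Z T
  triangle X Y := triangle_liftPt 𝓜 X Y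

variable {𝓜} (𝓢 : SymmetryVCat 𝓜)

/-- The points underlying the symmetry. -/
def symmetryPoints : PointTrans (C := C) (tensorExt M F P 𝓜).pseudo
    ((Bicategory.Prod.swap _ _).toPseudofunctor.comp (tensorExt M F P 𝓜).pseudo) where
  pt X := 𝓢.s X.1 X.2
  τ f := β_ (Kleisli.mk M (param (C := C) f.1)) (Kleisli.mk M (param (C := C) f.2))
  w f := arrow_symmetry_natural 𝓢 f.1 f.2
  natural η := BraidedCategory.braiding_naturality (repar (C := C) η.1) (repar (C := C) η.2)
  unit X := braiding_unit
  comp f g := braiding_tensorμ (Kleisli.mk M (param (C := C) f.1))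
    (Kleisli.mk M (param (C := C) g.1)) (Kleisli.mk M (param (C := C) f.2))
    (Kleisli.mk M (param (C := C) g.2))

/-- The symmetry of the nearly strict monoidal structure. -/
def paraSymmetry : NearlyStrictSymmetry (paraMonoidal M F P 𝓜) where
  s := (symmetryPoints M F P 𝓢).trans
  s_comp_s X Y := symmetry_liftPt 𝓢 X Y
  hexagon X Y Z := hexagon_liftPt 𝓢 X Y Z
  s_unit X := symmetry_unit_liftPt 𝓢 X

end monoidal
end ParaUncertainty

/-! ### The explicit description -/

theorem mainTheorem1
    {V : Type u₁} [Category.{v₁} V] [MonoidalCategory V] [SymmetricCategory V]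
    {W : Type u} [Category.{v} W] [MonoidalCategory W] [SymmetricCategory W]
    (M : Monad W) [M.toFunctor.LaxBraided] [NatTrans.IsMonoidal M.η] [NatTrans.IsMonoidal M.μ]
    (F : V ⥤ W) [F.LaxBraided] (P : ObjectProperty W) [IsStrictMonoidalSub P]
    {C : Type w} [EnrichedCategory V C] :
    -- the result of the change of base is a (strict) 2-category
    Bicategory.Strict (Para M F P C) ∧
    -- (i) 0-cells
    Function.Bijective (fun X : C => Para.of M F P X) ∧
    -- (ii) 1-cells
    (∀ X Y : C, Function.Bijective
      (fun k : (Σ U : {U : W // P U}, (Kleisli.mk M U.1 ⟶ (toKl M).obj (F.obj (X ⟶[V] Y)))) =>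
        (oneCell k.1.1 k.1.2 k.2 : Para.of M F P X ⟶ Para.of M F P Y))) ∧
    (∀ (X Y : C) (f : Para.of M F P X ⟶ Para.of M F P Y),
      f = oneCell (param f) (param_mem f) (arrow f)) ∧
    -- (iii) 2-cells and their vertical composition
    (∀ (X Y : C) (f g : Para.of M F P X ⟶ Para.of M F P Y),
      Function.Injective (fun φ : f ⟶ g => repar φ) ∧
      Set.range (fun φ : f ⟶ g => repar φ) = {φ | arrow f = φ ≫ arrow g}) ∧
    (∀ (X Y : C) (f : Para.of M F P X ⟶ Para.of M F P Y), repar (𝟙 f) = 𝟙 _) ∧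
    (∀ (X Y : C) (f g h : Para.of M F P X ⟶ Para.of M F P Y) (φ : f ⟶ g) (ψ : g ⟶ h),
      repar (φ ≫ ψ) = repar φ ≫ repar ψ) ∧
    -- (iv) identities and horizontal composition
    (∀ X : C, 𝟙 (Para.of M F P X) = liftPt (eId V X)) ∧
    (∀ (X Y Z : C) (f : Para.of M F P X ⟶ Para.of M F P Y)
      (g : Para.of M F P Y ⟶ Para.of M F P Z),
      f ≫ g = oneCell (param f ⊗ param g) (P.prop_tensor (param_mem f) (param_mem g))
        (liftOp (arrow f) (arrow g) (μ F _ _ ≫ F.map (eComp V X Y Z)))) ∧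
    (∀ (X Y Z : C) (f₁ g₁ : Para.of M F P X ⟶ Para.of M F P Y)
      (f₂ g₂ : Para.of M F P Y ⟶ Para.of M F P Z) (φ₁ : f₁ ⟶ g₁) (φ₂ : f₂ ⟶ g₂),
      repar (Bicategory.whiskerRight φ₁ f₂ ≫ Bicategory.whiskerLeft g₁ φ₂) =
        MonoidalCategoryStruct.tensorHom (repar φ₁) (repar φ₂)) ∧
    -- (v) the monoidal structure
    (∀ 𝓜 : MonoidalVCat V C,
      (∀ X Y : C, (paraTensor M F P 𝓜).obj (Para.of M F P X, Para.of M F P Y) =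
        Para.of M F P (𝓜.tensor X Y)) ∧
      (∀ (X₁ Y₁ X₂ Y₂ : C) (f₁ : Para.of M F P X₁ ⟶ Para.of M F P Y₁)
        (f₂ : Para.of M F P X₂ ⟶ Para.of M F P Y₂),
        (paraTensor M F P 𝓜).map (X := (Para.of M F P X₁, Para.of M F P X₂))
            (Y := (Para.of M F P Y₁, Para.of M F P Y₂)) (f₁, f₂) =
          oneCell (param f₁ ⊗ param f₂) (P.prop_tensor (param_mem f₁) (param_mem f₂))
            (liftOp (arrow f₁) (arrow f₂) (μ F _ _ ≫ F.map (𝓜.tensorHom X₁ Y₁ X₂ Y₂)))) ∧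
      (∀ (X₁ Y₁ X₂ Y₂ : C) (f₁ g₁ : Para.of M F P X₁ ⟶ Para.of M F P Y₁)
        (f₂ g₂ : Para.of M F P X₂ ⟶ Para.of M F P Y₂) (φ₁ : f₁ ⟶ g₁) (φ₂ : f₂ ⟶ g₂),
        repar (X := 𝓜.tensor X₁ X₂) (Y := 𝓜.tensor Y₁ Y₂)
            ((paraTensor M F P 𝓜).map₂ (a := (Para.of M F P X₁, Para.of M F P X₂))
              (b := (Para.of M F P Y₁, Para.of M F P Y₂)) (f := (f₁, f₂)) (g := (g₁, g₂))
              (φ₁, φ₂)) =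
          MonoidalCategoryStruct.tensorHom (repar φ₁) (repar φ₂)) ∧
      ∃ N : NearlyStrictMonoidal (paraTensor M F P 𝓜) (Para.of M F P 𝓜.unit),
        -- tensorators
        (∀ (X₁ Y₁ Z₁ X₂ Y₂ Z₂ : C)
          (f₁ : Para.of M F P X₁ ⟶ Para.of M F P Y₁) (f₂ : Para.of M F P X₂ ⟶ Para.of M F P Y₂)
          (g₁ : Para.of M F P Y₁ ⟶ Para.of M F P Z₁) (g₂ : Para.of M F P Y₂ ⟶ Para.of M F P Z₂),
          repar (X := 𝓜.tensor X₁ X₂) (Y := 𝓜.tensor Z₁ Z₂)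
              (N.ext.mapComp (a := (Para.of M F P X₁, Para.of M F P X₂))
                (b := (Para.of M F P Y₁, Para.of M F P Y₂))
                (c := (Para.of M F P Z₁, Para.of M F P Z₂)) (f₁, f₂) (g₁, g₂)).inv =
            (toKl M).map (tensorμ (param f₁) (param f₂) (param g₁) (param g₂))) ∧
        (∀ X₁ X₂ : C,
          repar (X := 𝓜.tensor X₁ X₂) (Y := 𝓜.tensor X₁ X₂)
              (N.ext.mapId (Para.of M F P X₁, Para.of M F P X₂)).hom =
            (toKl M).map (λ_ (𝟙_ W)).hom) ∧
        -- coherence 1-cells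
        (∀ X Y Z : C, N.a.app ((Para.of M F P X, Para.of M F P Y), Para.of M F P Z) =
          liftPt (𝓜.a X Y Z)) ∧
        (∀ X : C, N.l.app (Para.of M F P X) = liftPt (𝓜.l X)) ∧
        (∀ X : C, N.r.app (Para.of M F P X) = liftPt (𝓜.r X)) ∧
        -- the symmetric case
        (∀ 𝓢 : SymmetryVCat 𝓜, ∃ S : NearlyStrictSymmetry N,
          (∀ X Y : C, S.s.app (Para.of M F P X, Para.of M F P Y) = liftPt (𝓢.s X Y)) ∧
          (∀ (X₁ Y₁ X₂ Y₂ : C) (f₁ : Para.of M F P X₁ ⟶ Para.of M F P Y₁)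
            (f₂ : Para.of M F P X₂ ⟶ Para.of M F P Y₂),
            ∃ h₁ h₂, repar (X := 𝓜.tensor X₁ X₂) (Y := 𝓜.tensor Y₂ Y₁)
                (S.s.naturality (a := (Para.of M F P X₁, Para.of M F P X₂))
                  (b := (Para.of M F P Y₁, Para.of M F P Y₂)) (f₁, f₂)).hom =
              eqToHom h₁ ≫ (toKl M).map (β_ (param f₁) (param f₂)).hom ≫ eqToHom h₂))) := by
  refine ⟨inferInstance, Function.bijective_id, fun X Y => ?_, fun X Y f => rfl,
    fun X Y f g => ⟨repar_injective, ?_⟩, fun X Y f => rfl, fun X Y f g h φ ψ => rfl,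
    fun X => id_eq_liftPt X, fun X Y Z f g => ?_, fun X Y Z f₁ g₁ f₂ g₂ φ₁ φ₂ => ?_,
    fun 𝓜 => ⟨fun X Y => rfl, fun X₁ Y₁ X₂ Y₂ f₁ f₂ => ?_,
      fun X₁ Y₁ X₂ Y₂ f₁ g₁ f₂ g₂ φ₁ φ₂ => rfl, paraMonoidal M F P 𝓜,
      fun X₁ Y₁ Z₁ X₂ Y₂ Z₂ f₁ f₂ g₁ g₂ => (toKl_tensorμ _ _ _ _).symm, fun X₁ X₂ => rfl,
      fun X Y Z => rfl, fun X => rfl, fun X => rfl, fun 𝓢 => ⟨paraSymmetry M F P 𝓢,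
        fun X Y => rfl, fun X₁ Y₁ X₂ Y₂ f₁ f₂ => ?_⟩⟩⟩
  · exact Function.bijective_iff_has_inverse.2
      ⟨fun f => ⟨⟨param f, param_mem f⟩, arrow f⟩, fun _ => rfl, fun _ => rfl⟩
  · ext φ
    exact ⟨fun ⟨ψ, h⟩ => h ▸ repar_w ψ, fun h => ⟨twoCell φ h, rfl⟩⟩
  · exact oneCell_ext (𝟙 _) ⟨rfl, rfl⟩ ((arrow_comp f g).trans
      ((liftOp_eq_laxOp _ _ _).symm.trans (Category.id_comp _).symm))
  -- Whiskering tensors a reparametrization with an identity, so the claim is bifunctoriality of the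
  -- Kleisli tensor.
  · refine (tensorHom_comp_tensorHom (repar φ₁) (𝟙 (Kleisli.mk M (param f₂)))
      (𝟙 (Kleisli.mk M (param g₁))) (repar φ₂)).trans ?_
    exact congrArg₂ (fun x y => MonoidalCategoryStruct.tensorHom x y) (Category.comp_id _)
      (Category.id_comp _)
  · exact oneCell_ext (C := C) (𝟙 _) ⟨rfl, rfl⟩ ((arrow_tensor₁ 𝓜 f₁ f₂).trans
      ((liftOp_eq_laxOp _ _ _).symm.trans (Category.id_comp _).symm))
  -- The 1-cells compared have parameter spaces `(U₁ ⊗ U₂) ⊗ I` and `I ⊗ (U₂ ⊗ U₁)`; the two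
  -- transports remove the factor `I` contributed by the symmetry.
  · obtain ⟨h₁, e₁⟩ := isEqToHom_rightUnitor (P := P) (M := M)
      (P.prop_tensor (param_mem f₁) (param_mem f₂))
    obtain ⟨h₂, e₂⟩ := (isEqToHom_leftUnitor (P := P) (M := M)
      (P.prop_tensor (param_mem f₂) (param_mem f₁))).inv
    exact ⟨h₁, h₂, congrArg₂ (fun x y => x ≫ (toKl M).map (β_ _ _).hom ≫ y) e₁ e₂⟩
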